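/- **Setting.** Fix $\beta>0$, an integer $k\ge 1$ and $\gamma\in\mathbb{R}$. Let $\mathcal{S}$ be the set of probability measures $\mu=(\mu_i)_{i\ge 0}$ on $\mathbb{N}_0=\{0,1,2,\dots\}$ with finite mean $\overline{\mu}=\sum_i i\mu_i$, with the metric $d(\mu,\nu)=\sum_{i\ge 1} i|\mu_i-\nu_i|$. For $\mu\in\mathcal{S}$ put $$I(\mu)=\sum_{i=0}^\infty \mu_i\log(i!\,\mu_i)-\frac{\overline{\mu}}{2}\log(\overline{\mu}\beta)+\frac{\overline{\mu}+\beta}{2}\in(-\infty,\infty],\qquad \mu(f)=\sum_{i=0}^\infty\mu_i f(i),$$ with $0\log 0=0$. For $f:\mathbb{N}_0\to\mathbb{R}$ with $f(0)=0$ and $\limsup_{i\to\infty} f(i)/i<\infty$, and $\theta\ge 0$, let $\sigma_{\theta,f}\in\mathcal{S}$ be the law with masses $\frac{1}{i!}e^{-C(\theta,f)}\theta^i e^{f(i)}$, where $C(\theta,f)=\log\sum_i \frac{1}{i!}\theta^i e^{f(i)}$ and $0^0=1$; let $\Omega_f=\{\sigma_{\theta,f}:\theta\ge 0\}$ and $J(f)=\inf_{\theta\ge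 0}\{I(\sigma_{\theta,f})-\sigma_{\theta,f}(f)\}$. For a simple graph $G$ on $n$ labelled vertices let $E$ be its number of edges, $h_i$ its number of vertices of degree $i$, and $\mu^{(n)}\in\mathcal{S}$ its empirical degree distribution, with mass $h_i/n$ at $i$. Let $g(i)=\binom{i}{k}$. The $k$-star model is the probability distribution (for $n>\beta$) $$\mathbb{Q}_{n,\gamma g}(G)=\frac{1}{Z_n(\gamma g)}\Big(\frac{\beta}{n}\Big)^{E}\Big(1-\frac{\beta}{n}\Big)^{\binom n2-E}e^{\gamma\sum_{i=0}^{n-1}h_i g(i)},$$ where $Z_n(\gamma g)$ is the normalizing constant. **Theorem 1.3.** (a) If $\gamma>0$ and $k\ge 2$, then $\lim_{n\to\infty}\frac1n\log Z_n(\gamma g)=\infty$. (b) If $\gamma<0$, then $$\lim_{n\to\infty}\frac1n\log Z_n(\gamma g)=\sup_{\mu\in\mathcal{S}}\{\gamma\mu(g)-I(\mu)\}=-J(\gamma g)<0 .$$ (c) If $\gamma<0$, then the set $A_{\gamma g}$ of all $\mu\in\mathcal{S}$ at which the supremum in (b) is attained is non-empty, finite and contained in $\Omega_{\gamma g}$,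 and for every open $U\subset\mathcal{S}$ (for the metric $d$) containing $A_{\gamma g}$, $$\lim_{n\to\infty}\mathbb{Q}_{n,\gamma g}\big(\mu^{(n)}\in U^c\big)=0 .$$ -/

import Mathlib

open Filter Topology
open scoped NNReal

noncomputable section

namespace DegreeERGM

/-- The value in `[-∞, ∞]` of the series `∑ a i`: the sum of the positive parts minus the sum of
the negative parts. (It is only used where at least one of the two sums is finite.) -/
def extSum (a : ℕ → ℝ) : EReal :=
  ((∑' i, ENNReal.ofReal (a i) : ENNReal) : EReal) -
    ((∑' i, ENNReal.ofReal (-a i) : ENNReal) : EReal)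

/-- The set `𝒮` of probability measures on `{0, 1, 2, …}` with finite mean, each given by its
masses `μ i`. -/
@[ext]
structure FiniteMeanLaw where
  mass : ℕ → ℝ
  nonneg : ∀ i, 0 ≤ mass i
  hasSum_one : HasSum mass 1
  summable_mean : Summable fun i : ℕ => (i : ℝ) * mass i

namespace FiniteMeanLaw

/-- The mean of `μ`. -/
def mean (μ : FiniteMeanLaw) : ℝ := ∑' i : ℕ, (i : ℝ) * μ.mass i

/-- `μ(f) = ∑ μ i * f i`, with values in `[-∞, ∞]`. -/
def expect (μ : FiniteMeanLaw) (f : ℕ → ℝ) : EReal := extSum fun i => μ.mass i * f i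

theorem summable_dist (μ ν : FiniteMeanLaw) :
    Summable fun i : ℕ => (i : ℝ) * |μ.mass i - ν.mass i| := by
  have h := (μ.summable_mean.sub ν.summable_mean).abs
  refine h.congr fun i => ?_
  rw [← mul_sub, abs_mul, Nat.abs_cast]

/-- The metric `d(μ, ν) = ∑ i |μ i - ν i|`. -/
instance : MetricSpace FiniteMeanLaw where
  dist μ ν := ∑' i : ℕ, (i : ℝ) * |μ.mass i - ν.mass i|
  dist_self μ := by simp
  dist_comm μ ν := by simp only [abs_sub_comm]
  dist_triangle μ ν ρ := by
    rw [← (summable_dist μ ν).tsum_add (summable_dist ν ρ)]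
    refine (summable_dist μ ρ).tsum_le_tsum (fun i => ?_)
      ((summable_dist μ ν).add (summable_dist ν ρ))
    rw [← mul_add]
    exact mul_le_mul_of_nonneg_left (abs_sub_le _ _ _) (Nat.cast_nonneg i)
  eq_of_dist_eq_zero := by
    intro μ ν h
    change (∑' i : ℕ, (i : ℝ) * |μ.mass i - ν.mass i|) = 0 at h
    have h0 := ((summable_dist μ ν).hasSum_iff.2 h)
    rw [hasSum_zero_iff_of_nonneg (fun i => by positivity)] at h0
    have hpos : ∀ i : ℕ, i ≠ 0 → μ.mass i - ν.mass i = 0 := by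
      intro i hi
      have h1 := congrFun h0 i
      simp only [Pi.zero_apply, mul_eq_zero, Nat.cast_eq_zero, hi, false_or] at h1
      exact abs_eq_zero.1 h1
    have h2 : HasSum (fun i => μ.mass i - ν.mass i) (1 - 1) := μ.hasSum_one.sub ν.hasSum_one
    have h3 := h2.unique (hasSum_single 0 hpos)
    ext i
    by_cases hi : i = 0
    · subst hi; linarith
    · linarith [hpos i hi]

end FiniteMeanLaw

/-- The rate function
`I(μ) = ∑ μ i log (i! μ i) - (mean μ / 2) log (β mean μ) + (mean μ + β) / 2`. -/
def rate (β : ℝ) (μ : FiniteMeanLaw) : EReal :=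
  extSum (fun i => μ.mass i * Real.log ((Nat.factorial i : ℝ) * μ.mass i)) +
    ((-(μ.mean / 2) * Real.log (μ.mean * β) + (μ.mean + β) / 2 : ℝ) : EReal)

/-- The class `F` of functions with `f 0 = 0` and `limsup f i / i < ∞`. -/
def classF : Set (ℕ → ℝ) :=
  {f | f 0 = 0 ∧ limsup (fun i : ℕ => ((f i / i : ℝ) : EReal)) atTop < ⊤}

theorem exists_le_mul_of_mem_classF {f : ℕ → ℝ} (hf : f ∈ classF) :
    ∃ C : ℝ, ∀ i : ℕ, f i ≤ C * i := by
  obtain ⟨h0, hlim⟩ := hf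
  obtain ⟨b, hb1, -⟩ := EReal.lt_iff_exists_real_btwn.1 hlim
  have hev := eventually_lt_of_limsup_lt hb1
  obtain ⟨N, hN⟩ := eventually_atTop.1 hev
  refine ⟨|b| + ∑ j ∈ Finset.range N, |f j|, fun i => ?_⟩
  have hsum : 0 ≤ ∑ j ∈ Finset.range N, |f j| := Finset.sum_nonneg fun j _ => abs_nonneg _
  rcases Nat.eq_zero_or_pos i with rfl | hi
  · simp [h0]
  have hi1 : (1 : ℝ) ≤ i := by exact_mod_cast hi
  by_cases hiN : N ≤ i
  · have h1 : f i / i < b := by exact_mod_cast hN i hiN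
    rw [div_lt_iff₀ (by linarith)] at h1
    have h2 : b * i ≤ |b| * i := mul_le_mul_of_nonneg_right (le_abs_self b) (by linarith)
    nlinarith
  · have h1 : |f i| ≤ ∑ j ∈ Finset.range N, |f j| :=
      Finset.single_le_sum (f := fun j => |f j|) (fun j _ => abs_nonneg _)
        (Finset.mem_range.2 (not_le.1 hiN))
    have h2 := le_abs_self (f i)
    have h3 : 0 ≤ |b| := abs_nonneg b
    nlinarith

theorem summable_weight {f : ℕ → ℝ} (hf : f ∈ classF) (θ : ℝ≥0) :
    Summable fun i : ℕ => 1 / (Nat.factorial i : ℝ) * (θ : ℝ) ^ i * Real.exp (f i) := by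
  obtain ⟨C, hC⟩ := exists_le_mul_of_mem_classF hf
  refine Summable.of_nonneg_of_le (fun i => by positivity) (fun i => ?_)
    (Real.summable_pow_div_factorial ((θ : ℝ) * Real.exp C))
  have h : Real.exp (f i) ≤ Real.exp C ^ i := by
    rw [← Real.exp_nat_mul, mul_comm]
    exact Real.exp_le_exp.2 (hC i)
  calc 1 / (Nat.factorial i : ℝ) * (θ : ℝ) ^ i * Real.exp (f i)
      ≤ 1 / (Nat.factorial i : ℝ) * (θ : ℝ) ^ i * Real.exp C ^ i :=
        mul_le_mul_of_nonneg_left h (by positivity)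
    _ = ((θ : ℝ) * Real.exp C) ^ i / (Nat.factorial i : ℝ) := by rw [mul_pow]; ring

theorem summable_mul_weight {f : ℕ → ℝ} (hf : f ∈ classF) (θ : ℝ≥0) :
    Summable fun i : ℕ =>
      (i : ℝ) * (1 / (Nat.factorial i : ℝ) * (θ : ℝ) ^ i * Real.exp (f i)) := by
  obtain ⟨C, hC⟩ := exists_le_mul_of_mem_classF hf
  refine Summable.of_nonneg_of_le (fun i => by positivity) (fun i => ?_)
    (Real.summable_pow_div_factorial ((θ : ℝ) * Real.exp (C + 1)))
  have h1 : (i : ℝ) ≤ Real.exp i := by linarith [Real.add_one_le_exp (i : ℝ)]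
  have h : (i : ℝ) * Real.exp (f i) ≤ Real.exp (C + 1) ^ i := by
    calc (i : ℝ) * Real.exp (f i) ≤ Real.exp i * Real.exp (C * i) :=
          mul_le_mul h1 (Real.exp_le_exp.2 (hC i)) (Real.exp_pos _).le (Real.exp_pos _).le
      _ = Real.exp (C + 1) ^ i := by
          rw [← Real.exp_add, ← Real.exp_nat_mul]; congr 1; ring
  calc (i : ℝ) * (1 / (Nat.factorial i : ℝ) * (θ : ℝ) ^ i * Real.exp (f i))
      = 1 / (Nat.factorial i : ℝ) * (θ : ℝ) ^ i * ((i : ℝ) * Real.exp (f i)) := by ring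
    _ ≤ 1 / (Nat.factorial i : ℝ) * (θ : ℝ) ^ i * Real.exp (C + 1) ^ i :=
        mul_le_mul_of_nonneg_left h (by positivity)
    _ = ((θ : ℝ) * Real.exp (C + 1)) ^ i / (Nat.factorial i : ℝ) := by rw [mul_pow]; ring

/-- `C(θ, f) = log ∑ θ ^ i e ^ (f i) / i!`. -/
def logNorm (f : ℕ → ℝ) (θ : ℝ≥0) : ℝ :=
  Real.log (∑' i : ℕ, 1 / (Nat.factorial i : ℝ) * (θ : ℝ) ^ i * Real.exp (f i))

theorem exp_neg_logNorm {f : ℕ → ℝ} (hf : f ∈ classF) (θ : ℝ≥0) :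
    Real.exp (-logNorm f θ) *
      (∑' i : ℕ, 1 / (Nat.factorial i : ℝ) * (θ : ℝ) ^ i * Real.exp (f i)) = 1 := by
  have hpos : 0 < ∑' i : ℕ, 1 / (Nat.factorial i : ℝ) * (θ : ℝ) ^ i * Real.exp (f i) :=
    (summable_weight hf θ).tsum_pos (fun i => by positivity) 0 (by simp [Real.exp_pos])
  rw [logNorm, Real.exp_neg, Real.exp_log hpos, inv_mul_cancel₀ hpos.ne']

/-- The law `σ_{θ,f}`, with masses `θ ^ i e ^ (f i - C(θ, f)) / i!`. -/
def sigma (f : ℕ → ℝ) (hf : f ∈ classF) (θ : ℝ≥0) : FiniteMeanLaw where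
  mass i := Real.exp (-logNorm f θ) *
    (1 / (Nat.factorial i : ℝ) * (θ : ℝ) ^ i * Real.exp (f i))
  nonneg i := by positivity
  hasSum_one := by
    have h := (summable_weight hf θ).hasSum.mul_left (Real.exp (-logNorm f θ))
    rwa [exp_neg_logNorm hf θ] at h
  summable_mean :=
    ((summable_mul_weight hf θ).mul_left (Real.exp (-logNorm f θ))).congr fun i => by ring

/-- The family `Ω_f = {σ_{θ,f} : θ ≥ 0}`. -/
def Omega (f : ℕ → ℝ) (hf : f ∈ classF) : Set FiniteMeanLaw := Set.range (sigma f hf)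

/-- `J(f) = inf_{θ ≥ 0} (I(σ_{θ,f}) - σ_{θ,f}(f))`. -/
def J (β : ℝ) (f : ℕ → ℝ) (hf : f ∈ classF) : EReal :=
  ⨅ θ : ℝ≥0, (rate β (sigma f hf θ) - (sigma f hf θ).expect f)

/-- The function `i ↦ γ g(i)` with `g(i) = i choose k`. -/
def starFun (k : ℕ) (γ : ℝ) (i : ℕ) : ℝ := γ * (Nat.choose i k : ℝ)

theorem starFun_mem_classF {k : ℕ} (hk : 1 ≤ k) {γ : ℝ} (hγ : γ < 0) :
    starFun k γ ∈ classF := by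
  refine ⟨by simp [starFun, Nat.choose_eq_zero_of_lt hk], ?_⟩
  refine lt_of_le_of_lt (b := ((0 : ℝ) : EReal)) ?_ (EReal.coe_lt_top 0)
  refine limsup_le_of_le (by isBoundedDefault) (Eventually.of_forall fun i => ?_)
  rw [EReal.coe_le_coe_iff]
  exact div_nonpos_of_nonpos_of_nonneg
    (mul_nonpos_of_nonpos_of_nonneg hγ.le (Nat.cast_nonneg _)) (Nat.cast_nonneg _)

section Graphs

open Classical in
/-- The number `h_i` of vertices of degree `i`. -/
def degFreq {n : ℕ} (G : SimpleGraph (Fin n)) (i : ℕ) : ℕ :=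
  (Finset.univ.filter fun v => G.degree v = i).card

open Classical in
theorem sum_mul_degFreq {n : ℕ} (G : SimpleGraph (Fin n)) :
    ∑ i ∈ Finset.range n, (degFreq G i : ℝ) = n := by
  have h : (Finset.univ : Finset (Fin n)).card = ∑ i ∈ Finset.range n, degFreq G i :=
    Finset.card_eq_sum_card_fiberwise fun v _ => by
      simpa using G.degree_lt_card_verts v
  rw [Finset.card_univ, Fintype.card_fin] at h
  exact_mod_cast h.symm

open Classical in
theorem degFreq_eq_zero {n : ℕ} (G : SimpleGraph (Fin n)) {i : ℕ} (hi : i ∉ Finset.range n) :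
    degFreq G i = 0 := by
  rw [degFreq, Finset.card_eq_zero, Finset.filter_eq_empty_iff]
  intro v _ hv
  have := G.degree_lt_card_verts v
  rw [Fintype.card_fin, hv] at this
  exact hi (Finset.mem_range.2 this)

/-- The empirical degree distribution `μ⁽ⁿ⁾` of a graph, with mass `h_i / n` at `i`. -/
def empirical {n : ℕ} [NeZero n] (G : SimpleGraph (Fin n)) : FiniteMeanLaw where
  mass i := (degFreq G i : ℝ) / n
  nonneg i := by positivity
  hasSum_one := by
    have h := hasSum_sum_of_ne_finset_zero (f := fun i => (degFreq G i : ℝ) / n)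
      (s := Finset.range n) (L := SummationFilter.unconditional ℕ)
      fun i hi => by simp [degFreq_eq_zero G hi]
    rwa [← Finset.sum_div, sum_mul_degFreq,
      div_self (Nat.cast_ne_zero.2 (NeZero.ne n))] at h
  summable_mean := summable_of_ne_finset_zero (s := Finset.range n) fun i hi => by
    simp [degFreq_eq_zero G hi]

open Classical in
/-- The unnormalised weight of `G`: the Erdős–Rényi(`β / n`) probability of `G` times
`exp (∑ h_i f(i))`. -/
def weight (β : ℝ) (f : ℕ → ℝ) {n : ℕ} (G : SimpleGraph (Fin n)) : ℝ :=
  (β / n) ^ G.edgeFinset.card * (1 - β / n) ^ (n.choose 2 - G.edgeFinset.card) *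
    Real.exp (∑ i ∈ Finset.range n, (degFreq G i : ℝ) * f i)

open Classical in
/-- The normalising constant `Z_n(f)`. -/
def Z (β : ℝ) (f : ℕ → ℝ) (n : ℕ) : ℝ := ∑ G : SimpleGraph (Fin n), weight β f G

open Classical in
/-- The probability `Q_{n,f}(B)` of a set `B` of graphs on `n` labelled vertices; a probability
distribution as soon as `n > β`. -/
def Q (β : ℝ) (f : ℕ → ℝ) (n : ℕ) (B : Set (SimpleGraph (Fin n))) : ℝ :=
  ∑ G ∈ Finset.univ.filter (· ∈ B), weight β f G / Z β f n

end Graphs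

/-- The functional `μ ↦ γ μ(g) - I(μ)` with `g(i) = i choose k`. -/
def starFunctional (β : ℝ) (k : ℕ) (γ : ℝ) (μ : FiniteMeanLaw) : EReal :=
  (γ : EReal) * μ.expect (fun i => (Nat.choose i k : ℝ)) - rate β μ

/-- The set of all `μ` at which `sup_ν (γ ν(g) - I(ν))` is attained. -/
def starMaximizers (β : ℝ) (k : ℕ) (γ : ℝ) : Set FiniteMeanLaw :=
  {μ | starFunctional β k γ μ = ⨆ ν, starFunctional β k γ ν}

end DegreeERGM

end

open DegreeERGM

/-! For `γ < 0` put `f = starFun k γ`. A graph whose degree sequence is `d` has `∏ (d v)!` labelings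
of its edge ends by sets of sizes `d v`. Building labelled graphs edge by edge shows that at most `2
^ E * E!` of them with `E` edges use up all labels (`labeledCount_le`), and that for bounded `d` at
least `2 ^ J * J!` of them with `J` edges exist when boundedly many labels are left over
(`le_labeledCount`). So the sum over graphs compares, up to subexponential factors, with a sum over
degree sequences of `(2x)^E E! ∏ e^(f (d v)) / (d v)!`, where `x = β / (n - β)`. With `θ² = 2xE`,
Stirling's bound turns the terms with `E` edges into `e^(-E)` times a part of `(pgf f θ)^n`. Since
`E` is about `n θ² / (2β)` and `(1 - β/n)^(n choose 2)` is about `e^(-nβ/2)`, their contribution to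
`Z` is at most about `exp (-n * dualRate β f θ)`; the lower bound holds for every `θ`. Hence `log Z
/ n` tends to `-min dualRate` (`tendsto_log_Z`).

The variational formula rests on one identity: if `θ² = β * mean μ`, then `freeEnergy μ - dualRate
θ` is the relative entropy of `μ` with respect to `sigma f hf θ` (`dualRate_meanParam_le`). Together
with `freeEnergy_sigma_le` it identifies the infimum of the free energy, over all laws or over the
exponential family, with the minimum of `dualRate`.

The minimizer is unique. Minimizers satisfy `θ² = β * mean (sigma θ)`, a power series equation whose
coefficients change sign once because the two-step increments of `f` decrease (`eq_of_sq_eq`); this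
is Descartes' rule of signs. The set of maximizers is therefore a singleton.

For concentration, an edge number `E` whose `θ` is far from the minimizer loses an exponential
factor through `dualRate` (`exists_gap`). If `θ` is near, degree frequencies deviate with
exponentially small weight by a Chernoff bound, while the mean degree is already fixed by `E`. For
`γ > 0` and `k ≥ 2` the complete graph alone forces divergence. -/

namespace DegreeERGM

/-! ### Counting graphs with labelled edge ends. -/

section GraphCounting

open SimpleGraph

open Classical in
theorem degree_eq_sum_ite {n : ℕ} (G : SimpleGraph (Fin n)) (v : Fin n)
    [Fintype (G.neighborSet v)] : G.degree v = ∑ x, if G.Adj v x then 1 else 0 := by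
  rw [show G.degree v = @degree _ G v (Subtype.fintype _) from by congr!,
    ← card_neighborFinset_eq_degree, neighborFinset_eq_filter, Finset.card_filter]

open Classical in
theorem degree_sup_edge {n : ℕ} {G : SimpleGraph (Fin n)} {u v : Fin n} (huv : u ≠ v)
    (h : ¬ G.Adj u v) (x : Fin n) [Fintype ((G ⊔ edge u v).neighborSet x)] :
    (G ⊔ edge u v).degree x = G.degree x + (if x = u then 1 else 0) + (if x = v then 1 else 0) := by
  have h' : ¬ G.Adj v u := fun h1 => h h1.symm
  have key : ∀ y, (if (G ⊔ edge u v).Adj x y then 1 else 0) =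
      (if G.Adj x y then 1 else 0) + (if y = v then (if x = u then 1 else 0) else 0) +
        (if y = u then (if x = v then 1 else 0) else 0) := by
    intro y
    simp only [sup_adj, edge_adj]
    by_cases hxu : x = u <;> by_cases hxv : x = v <;> by_cases hyu : y = u <;>
      by_cases hyv : y = v <;> subst_vars <;> simp_all
  rw [degree_eq_sum_ite, degree_eq_sum_ite]
  refine (Finset.sum_congr rfl fun y _ => (?_ : _ = _)).trans (?_ :
    ∑ y, ((if G.Adj x y then 1 else 0) + (if y = v then (if x = u then 1 else 0) else 0) +
        (if y = u then (if x = v then 1 else 0) else 0)) = _)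
  · convert key y
  simp [Finset.sum_add_distrib]

open Classical in
/-- The number of ways to label, at each vertex `v`, the edges of `G` by distinct elements of a set
of size `d v`. -/
noncomputable def labelings {n : ℕ} (d : Fin n → ℕ) (G : SimpleGraph (Fin n)) : ℝ :=
  ∏ v, ((d v).descFactorial (G.degree v) : ℝ)

theorem labelings_nonneg {n : ℕ} (d : Fin n → ℕ) (G : SimpleGraph (Fin n)) :
    0 ≤ labelings d G := Finset.prod_nonneg fun _ _ => Nat.cast_nonneg _

open Classical in
theorem degree_le_of_labelings_ne_zero {n : ℕ} {d : Fin n → ℕ} {G : SimpleGraph (Fin n)}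
    (h : labelings d G ≠ 0) (v : Fin n) : G.degree v ≤ d v := by
  by_contra hv
  refine h (Finset.prod_eq_zero (Finset.mem_univ v) ?_)
  rw [Nat.descFactorial_eq_zero_iff_lt.2 (not_le.1 hv), Nat.cast_zero]

open Classical in
theorem labelings_le {n : ℕ} (d : Fin n → ℕ) (G : SimpleGraph (Fin n)) :
    labelings d G ≤ if ∀ v, G.degree v ≤ d v then ∏ v, ((d v).factorial : ℝ) else 0 := by
  split_ifs with h
  · refine Finset.prod_le_prod (fun _ _ => Nat.cast_nonneg _) fun v _ => ?_
    rw [Nat.cast_le, ← Nat.factorial_mul_descFactorial (h v)]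
    exact Nat.le_mul_of_pos_left _ (Nat.factorial_pos _)
  · by_contra hne
    have h0 := (labelings_nonneg d G).lt_of_ne' (fun h0 => hne h0.le)
    exact h (degree_le_of_labelings_ne_zero h0.ne')

open Classical in
theorem labelings_degree {n : ℕ} (G : SimpleGraph (Fin n)) :
    labelings (fun v => G.degree v) G = ∏ v, ((G.degree v).factorial : ℝ) := by
  simp [labelings, Nat.descFactorial_self]

theorem cast_descFactorial_succ (d k : ℕ) :
    ((d.descFactorial (k + 1) : ℕ) : ℝ) = ((d : ℝ) - k) * (d.descFactorial k : ℕ) := by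
  rw [Nat.descFactorial_succ, Nat.cast_mul]
  rcases le_or_gt k d with h | h
  · rw [Nat.cast_sub h]
  · simp [Nat.descFactorial_eq_zero_iff_lt.2 h]

open Classical in
-- The new edge takes one unused label at `u` and one at `v`. A residual is negative only if the
-- labelings of `G` already vanish, so real subtraction is harmless.
theorem labelings_sup_edge {n : ℕ} (d : Fin n → ℕ) {G : SimpleGraph (Fin n)} {u v : Fin n}
    (huv : u ≠ v) (h : ¬ G.Adj u v) :
    labelings d (G ⊔ edge u v) =
      labelings d G * (((d u : ℝ) - G.degree u) * ((d v : ℝ) - G.degree v)) := by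
  have key : ∀ (H : SimpleGraph (Fin n)) (_ : H = G ⊔ edge u v) (x : Fin n),
      ((d x).descFactorial (H.degree x) : ℝ) =
        ((d x).descFactorial (G.degree x) : ℝ) * ((if x = u then ((d u : ℝ) - G.degree u) else 1) *
        (if x = v then ((d v : ℝ) - G.degree v) else 1)) := by
    rintro H rfl x
    rw [degree_sup_edge huv h]
    by_cases hxu : x = u
    · subst hxu
      simp only [huv, if_true, if_false, add_zero, cast_descFactorial_succ]
      ring
    · by_cases hxv : x = v
      · subst hxv
        simp only [hxu, if_true, if_false, add_zero, cast_descFactorial_succ]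
        ring
      · simp [hxu, hxv]
  rw [labelings]
  refine Eq.trans (Finset.prod_congr rfl fun x _ => key _ rfl x) ?_
  rw [Finset.prod_mul_distrib, Finset.prod_mul_distrib]
  simp [labelings]

open Classical in
/-- The number of graphs with `j` edges whose edges are labelled at each vertex `v` by distinct
elements of a set of size `d v`. -/
noncomputable def labeledCount {n : ℕ} (d : Fin n → ℕ) (j : ℕ) : ℝ :=
  ∑ G : SimpleGraph (Fin n) with G.edgeFinset.card = j, labelings d G

open Classical in
theorem labeledCount_zero {n : ℕ} (d : Fin n → ℕ) : labeledCount d 0 = 1 := by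
  have : (Finset.univ.filter fun G : SimpleGraph (Fin n) => G.edgeFinset.card = 0) = {⊥} := by
    ext G
    simp
  rw [labeledCount, this, Finset.sum_singleton]
  simp [labelings]

open Classical in
theorem sum_adj_pairs {n : ℕ} (G : SimpleGraph (Fin n)) :
    ∑ u, ∑ v, (if G.Adj u v then (1 : ℝ) else 0) = 2 * G.edgeFinset.card := by
  have h := G.sum_degrees_eq_twice_card_edges
  have h2 : ((∑ v, G.degree v : ℕ) : ℝ) = 2 * G.edgeFinset.card := by
    rw [h]; push_cast; rfl
  rw [← h2]
  push_cast [degree_eq_sum_ite]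
  rfl

open Classical in
theorem sum_graphs_adj {n : ℕ} (Φ : SimpleGraph (Fin n) → ℝ) (j : ℕ) {u v : Fin n} (huv : u ≠ v) :
    ∑ G : SimpleGraph (Fin n) with G.edgeFinset.card = j + 1, (if G.Adj u v then Φ G else 0) =
      ∑ G : SimpleGraph (Fin n) with G.edgeFinset.card = j,
        (if G.Adj u v then 0 else Φ (G ⊔ edge u v)) := by
  rw [← Finset.sum_filter, Finset.sum_congr rfl fun (G : SimpleGraph (Fin n)) _ =>
    (ite_not (G.Adj u v) (Φ (G ⊔ edge u v)) 0).symm, ← Finset.sum_filter,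
    Finset.filter_filter, Finset.filter_filter]
  have hadd : ∀ G H : SimpleGraph (Fin n), H = G ⊔ edge u v →
      ¬ G.Adj u v → H.edgeFinset.card = G.edgeFinset.card + 1 := by
    rintro G H rfl hG
    rw [← card_edgeFinset_sup_edge G hG huv]
    congr!
  have hdel : ∀ G : SimpleGraph (Fin n), G.Adj u v → G.deleteEdges {s(u, v)} ⊔ edge u v = G := by
    intro G hG
    ext a b
    simp only [sup_adj, deleteEdges_adj, edge_adj, Set.mem_singleton_iff, Sym2.eq_iff]
    constructor
    · rintro (h | ⟨⟨rfl, rfl⟩ | ⟨rfl, rfl⟩, -⟩)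
      · exact h.1
      · exact hG
      · exact hG.symm
    · intro h
      by_cases h2 : (a = u ∧ b = v ∨ a = v ∧ b = u)
      · exact Or.inr ⟨h2, h.ne⟩
      · exact Or.inl ⟨h, h2⟩
  refine Finset.sum_nbij' (fun G => G.deleteEdges {s(u, v)}) (fun G => G ⊔ edge u v) ?_ ?_ ?_ ?_ ?_
  · intro G hG
    simp only [Finset.mem_filter, Finset.mem_univ, true_and] at hG ⊢
    have h1 : ¬ (G.deleteEdges {s(u, v)}).Adj u v := by simp
    have h2 := hadd _ G (hdel G hG.2).symm h1
    exact ⟨by omega, h1⟩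
  · intro G hG
    simp only [Finset.mem_filter, Finset.mem_univ, true_and] at hG ⊢
    exact ⟨by rw [hadd G _ rfl hG.2, hG.1], by simp [edge_adj, huv]⟩
  · intro G hG
    simp only [Finset.mem_filter, Finset.mem_univ, true_and] at hG
    exact hdel G hG.2
  · intro G hG
    simp only [Finset.mem_filter, Finset.mem_univ, true_and] at hG
    ext a b
    simp only [sup_adj, deleteEdges_adj, edge_adj, Set.mem_singleton_iff, Sym2.eq_iff]
    constructor
    · rintro ⟨h | h, h2⟩
      · exact h
      · exact absurd h.1 h2
    · intro h
      refine ⟨Or.inl h, ?_⟩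
      rintro (⟨rfl, rfl⟩ | ⟨rfl, rfl⟩)
      · exact hG.2 h
      · exact hG.2 h.symm
  · intro G hG
    simp only [Finset.mem_filter, Finset.mem_univ, true_and] at hG
    simp only [hdel G hG.2]

open Classical in
-- Double counting of pairs formed by a graph with `j + 1` edges and one of its oriented edges:
-- removing that edge leaves a graph with `j` edges and a nonadjacent pair.
theorem labeledCount_succ {n : ℕ} (d : Fin n → ℕ) (j : ℕ) :
    2 * ((j : ℝ) + 1) * labeledCount d (j + 1) =
      ∑ G : SimpleGraph (Fin n) with G.edgeFinset.card = j, labelings d G *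
        ∑ u, ∑ v, if u = v ∨ G.Adj u v then 0 else
          ((d u : ℝ) - G.degree u) * ((d v : ℝ) - G.degree v) := by
  have h1 : 2 * ((j : ℝ) + 1) * labeledCount d (j + 1) =
      ∑ G : SimpleGraph (Fin n) with G.edgeFinset.card = j + 1,
        ∑ u, ∑ v, if G.Adj u v then labelings d G else 0 := by
    rw [labeledCount, Finset.mul_sum]
    refine Finset.sum_congr rfl fun G hG => ?_
    have h2 := sum_adj_pairs G
    rw [(Finset.mem_filter.1 hG).2] at h2
    push_cast at h2
    rw [← h2, Finset.sum_mul]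
    refine Finset.sum_congr rfl fun u _ => ?_
    rw [Finset.sum_mul]
    refine Finset.sum_congr rfl fun v _ => ?_
    split_ifs <;> simp
  rw [h1, Finset.sum_comm]
  simp_rw [Finset.mul_sum]
  rw [Finset.sum_comm (s := Finset.univ.filter _)]
  refine Finset.sum_congr rfl fun u _ => ?_
  rw [Finset.sum_comm, Finset.sum_comm (s := Finset.univ.filter _)]
  refine Finset.sum_congr rfl fun v _ => ?_
  by_cases huv : u = v
  · subst huv; simp
  · rw [sum_graphs_adj _ _ huv]
    refine Finset.sum_congr rfl fun G _ => ?_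
    by_cases hG : G.Adj u v
    · simp [hG]
    · simp [hG, huv, labelings_sup_edge d huv hG]

open Classical in
theorem sum_residual {n : ℕ} (d : Fin n → ℕ) {G : SimpleGraph (Fin n)} {j : ℕ}
    (hG : G.edgeFinset.card = j) :
    ∑ v, ((d v : ℝ) - G.degree v) = (∑ v, (d v : ℝ)) - 2 * j := by
  have h := G.sum_degrees_eq_twice_card_edges
  rw [Finset.sum_sub_distrib, ← Nat.cast_sum (f := fun v => G.degree v), h, hG]
  push_cast
  ring

/-- Residuals are nonnegative wherever labelings exist, so allowing all ordered pairs only increases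
the sum, which then factors as the square of the total residual. -/
theorem labeledCount_succ_le {n : ℕ} (d : Fin n → ℕ) (j : ℕ) :
    2 * ((j : ℝ) + 1) * labeledCount d (j + 1) ≤
      ((∑ v, (d v : ℝ)) - 2 * j) ^ 2 * labeledCount d j := by
  classical
  rw [labeledCount_succ, labeledCount, Finset.mul_sum]
  refine Finset.sum_le_sum fun G hG => ?_
  rw [mul_comm]
  by_cases h0 : labelings d G = 0
  · simp [h0]
  refine mul_le_mul_of_nonneg_right ?_ (labelings_nonneg _ _)
  have hr : ∀ v, 0 ≤ (d v : ℝ) - G.degree v := fun v =>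
    sub_nonneg.2 (Nat.cast_le.2 (degree_le_of_labelings_ne_zero h0 v))
  have hs := sum_residual d (Finset.mem_filter.1 hG).2
  rw [← hs, sq, Finset.sum_mul_sum]
  refine Finset.sum_le_sum fun u _ => Finset.sum_le_sum fun v _ => ?_
  split_ifs
  · exact mul_nonneg (hr u) (hr v)
  · exact le_rfl

/-- The partners forbidden to `u` are `u` itself, with residual at most `D`, and at most `D`
neighbours with residual at most `D` each. -/
theorem le_labeledCount_succ {n : ℕ} {d : Fin n → ℕ} {D : ℕ} (hD : ∀ v, d v ≤ D) (j : ℕ) :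
    ((∑ v, (d v : ℝ)) - 2 * j) * ((∑ v, (d v : ℝ)) - 2 * j - (D + D ^ 2)) * labeledCount d j ≤
      2 * ((j : ℝ) + 1) * labeledCount d (j + 1) := by
  classical
  rw [labeledCount_succ, labeledCount, Finset.mul_sum]
  refine Finset.sum_le_sum fun G hG => ?_
  rw [mul_comm]
  by_cases h0 : labelings d G = 0
  · simp [h0]
  refine mul_le_mul_of_nonneg_left ?_ (labelings_nonneg _ _)
  have hdeg := degree_le_of_labelings_ne_zero h0
  have hr : ∀ v, 0 ≤ (d v : ℝ) - G.degree v := fun v =>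
    sub_nonneg.2 (Nat.cast_le.2 (hdeg v))
  have hrD : ∀ v, (d v : ℝ) - G.degree v ≤ D := fun v => by
    have h1 : (d v : ℝ) ≤ D := by exact_mod_cast hD v
    have h2 : (0 : ℝ) ≤ G.degree v := by positivity
    linarith
  have hs := sum_residual d (Finset.mem_filter.1 hG).2
  rw [← hs]
  clear hs
  generalize hrdef : (fun v => (d v : ℝ) - G.degree v) = r
  have hr' : ∀ v, (d v : ℝ) - G.degree v = r v := fun v => by rw [← hrdef]
  simp only [hr'] at hr hrD ⊢
  change (∑ v, r v) * ((∑ v, r v) - _) ≤ ∑ u, ∑ v, if u = v ∨ G.Adj u v then 0 else r u * r v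
  rw [Finset.sum_mul]
  refine Finset.sum_le_sum fun u _ => ?_
  have h1 : ∀ v, (if u = v ∨ G.Adj u v then 0 else r u * r v) =
      r u * (r v - (if u = v then r v else 0) - (if G.Adj u v then r v else 0)) := by
    intro v
    by_cases huv : u = v
    · subst huv; simp
    · by_cases h : G.Adj u v <;> simp [huv, h]
  rw [Finset.sum_congr rfl fun v _ => h1 v, ← Finset.mul_sum, Finset.sum_sub_distrib,
    Finset.sum_sub_distrib]
  refine mul_le_mul_of_nonneg_left ?_ (hr u)
  have h2 : ∑ v, (if u = v then r v else 0) ≤ D := by simpa using hrD u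
  have h3 : ∑ v, (if G.Adj u v then r v else 0) ≤ (D : ℝ) ^ 2 := by
    calc ∑ v, (if G.Adj u v then r v else 0)
        ≤ ∑ v, (if G.Adj u v then (1 : ℝ) else 0) * D := by
          refine Finset.sum_le_sum fun v _ => ?_
          split_ifs
          · simpa using hrD v
          · simp
      _ = (G.degree u : ℝ) * D := by
          rw [← Finset.sum_mul, degree_eq_sum_ite]
          push_cast
          rfl
      _ ≤ D * D := by
          refine mul_le_mul_of_nonneg_right ?_ (Nat.cast_nonneg _)
          exact_mod_cast (hdeg u).trans (hD u)
      _ = (D : ℝ) ^ 2 := by ring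
  linarith

theorem cast_choose_succ_mul (E j : ℕ) :
    (E.choose (j + 1) : ℝ) * ((j : ℝ) + 1) = E.choose j * ((E : ℝ) - j) := by
  rcases le_or_gt j E with h | h
  · rw [← Nat.cast_sub h]
    exact_mod_cast Nat.choose_succ_right_eq E j
  · simp [Nat.choose_eq_zero_of_lt h, Nat.choose_eq_zero_of_lt (h.trans (Nat.lt_succ_self j))]

/-- At most `2 ^ E * E !` labelled graphs exhaust the labels. -/
theorem labeledCount_le {n : ℕ} {d : Fin n → ℕ} {E : ℕ} (hd : ∑ v, d v = 2 * E) :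
    labeledCount d E ≤ 2 ^ E * E.factorial := by
  have hS : ∑ v, (d v : ℝ) = 2 * E := by exact_mod_cast hd
  -- The right side solves the recursion with ratio `(2E - 2j)² / (2(j + 1))` and equals `2 ^ E *
  -- E!` at `j = E`.
  have key : ∀ j ≤ E, labeledCount d j ≤ 2 ^ j * E.descFactorial j * E.choose j := by
    intro j
    induction j with
    | zero => intro _; simp [labeledCount_zero]
    | succ j ih =>
      intro hj
      have h1 := labeledCount_succ_le d j
      have h2 := ih (by omega)
      rw [hS] at h1
      have h3 : (0 : ℝ) < 2 * ((j : ℝ) + 1) := by positivity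
      refine le_of_mul_le_mul_left (h1.trans ?_) h3
      calc (2 * (E : ℝ) - 2 * j) ^ 2 * labeledCount d j
          ≤ (2 * (E : ℝ) - 2 * j) ^ 2 * (2 ^ j * E.descFactorial j * E.choose j) :=
            mul_le_mul_of_nonneg_left h2 (sq_nonneg _)
        _ = 2 * 2 ^ (j + 1) * (((E : ℝ) - j) * E.descFactorial j) *
              (E.choose j * ((E : ℝ) - j)) := by ring
        _ = _ := by
          rw [← cast_choose_succ_mul, cast_descFactorial_succ]; ring
  simpa [Nat.descFactorial_self] using key E le_rfl

/-- The unused labels absorb the loss `D + D ^ 2`: both factors of the lower recursion stay at least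
`2J - 2j`, so the closed form of the upper bound reappears with `J` in place of `E`. -/
theorem le_labeledCount {n : ℕ} {d : Fin n → ℕ} {D J : ℕ} (hD : ∀ v, d v ≤ D)
    (hd : 2 * J + (D + D ^ 2) ≤ ∑ v, d v) :
    (2 ^ J * J.factorial : ℝ) ≤ labeledCount d J := by
  have hS : 2 * (J : ℝ) + (D + D ^ 2) ≤ ∑ v, (d v : ℝ) := by exact_mod_cast hd
  have key : ∀ j ≤ J, (2 ^ j * J.descFactorial j * J.choose j : ℝ) ≤ labeledCount d j := by
    intro j
    induction j with
    | zero => intro _; simp [labeledCount_zero]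
    | succ j ih =>
      intro hj
      have h1 := le_labeledCount_succ hD j
      have h2 := ih (by omega)
      have h3 : (0 : ℝ) < 2 * ((j : ℝ) + 1) := by positivity
      have hjJ : (j : ℝ) + 1 ≤ J := by exact_mod_cast hj
      refine le_of_mul_le_mul_left (le_trans ?_ h1) h3
      have hDD : (0 : ℝ) ≤ D + (D : ℝ) ^ 2 := by positivity
      calc 2 * ((j : ℝ) + 1) * (2 ^ (j + 1) * (J.descFactorial (j + 1) : ℕ) * (J.choose (j + 1)))
          = 2 * 2 ^ (j + 1) * (((J : ℝ) - j) * J.descFactorial j) *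
              (J.choose (j + 1) * ((j : ℝ) + 1)) := by
            rw [cast_descFactorial_succ]; ring
        _ = ((2 * (J : ℝ) - 2 * j) * (2 * J - 2 * j)) *
              (2 ^ j * J.descFactorial j * J.choose j) := by
            rw [cast_choose_succ_mul]; ring
        _ ≤ _ := by
            refine mul_le_mul ?_ h2 (by positivity) ?_
            · refine mul_le_mul ?_ ?_ ?_ ?_ <;> linarith
            · refine mul_nonneg ?_ ?_ <;> linarith
  simpa [Nat.descFactorial_self] using key J le_rfl

/-! ### From sums over graphs to sums over degree sequences. -/

open Classical in
theorem sum_degFreq_mul {n : ℕ} (G : SimpleGraph (Fin n)) (f : ℕ → ℝ) :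
    ∑ i ∈ Finset.range n, (degFreq G i : ℝ) * f i = ∑ v, f (G.degree v) := by
  rw [← Finset.sum_fiberwise_of_maps_to (s := Finset.univ) (t := Finset.range n)
    (g := fun v => G.degree v) fun v _ => by simpa using G.degree_lt_card_verts v]
  refine Finset.sum_congr rfl fun i _ => ?_
  rw [Finset.sum_congr rfl fun v hv => by rw [(Finset.mem_filter.1 hv).2], Finset.sum_const,
    nsmul_eq_mul, degFreq]

open Classical in
theorem card_edgeFinset_le {n : ℕ} (G : SimpleGraph (Fin n)) :
    G.edgeFinset.card ≤ n.choose 2 := by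
  have h := G.card_edgeFinset_le_card_choose_two
  rwa [Fintype.card_fin] at h

open Classical in
/-- The weight of `G`, up to the factor `(1 - β / n) ^ (n.choose 2)`. -/
noncomputable def graphWeight {n : ℕ} (x : ℝ) (w : ℕ → ℝ) (G : SimpleGraph (Fin n)) : ℝ :=
  x ^ G.edgeFinset.card * ∏ v, w (G.degree v)

theorem graphWeight_nonneg {n : ℕ} {x : ℝ} (hx : 0 ≤ x) {w : ℕ → ℝ} (hw : ∀ i, 0 ≤ w i)
    (G : SimpleGraph (Fin n)) : 0 ≤ graphWeight x w G :=
  mul_nonneg (pow_nonneg hx _) (Finset.prod_nonneg fun _ _ => hw _)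

/-- The edge parameter `β / (n - β)` is the odds ratio `p / (1 - p)` for `p = β / n`. -/
theorem weight_eq {β : ℝ} {f : ℕ → ℝ} {n : ℕ} (hn : β < n) (hβ : 0 < β)
    (G : SimpleGraph (Fin n)) :
    weight β f G = (1 - β / n) ^ n.choose 2 *
      graphWeight (β / (n - β)) (fun i => Real.exp (f i)) G := by
  classical
  have hn0 : (0 : ℝ) < n := hβ.trans hn
  have h1 : (0 : ℝ) < 1 - β / n := by rw [sub_pos, div_lt_one hn0]; exact hn
  have h2 : β / (n - β) = (β / n) / (1 - β / n) := by
    have : (n : ℝ) - β ≠ 0 := by linarith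
    field_simp
  have h3 : (1 - β / n) ^ n.choose 2 =
      (1 - β / n) ^ (n.choose 2 - G.edgeFinset.card) * (1 - β / n) ^ G.edgeFinset.card := by
    rw [← pow_add, Nat.sub_add_cancel (card_edgeFinset_le G)]
  rw [weight, graphWeight, sum_degFreq_mul, Real.exp_sum, h2, div_pow (β / n), h3]
  generalize 1 - β / (n : ℝ) = q at h1
  field_simp

open Classical in
/-- Upper bound for a sum over graphs by a sum over degree sequences. -/
theorem sum_graphWeight_le {n : ℕ} {x : ℝ} (hx : 0 ≤ x) {w : ℕ → ℝ} (hw : ∀ i, 0 ≤ w i)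
    (T : Set (Fin n → ℕ)) :
    ∑ G : SimpleGraph (Fin n) with (fun v => G.degree v) ∈ T, graphWeight x w G ≤
      ∑ E ∈ Finset.range (n ^ 2 + 1), (2 * x) ^ E * E.factorial *
        ∑ d ∈ Fintype.piFinset (fun _ : Fin n => Finset.range n) with
          ∑ v, d v = 2 * E ∧ d ∈ T, ∏ v, (w (d v) / (d v).factorial) := by
  rw [← Finset.sum_fiberwise_of_maps_to (t := Finset.range (n ^ 2 + 1))
    (g := fun G : SimpleGraph (Fin n) => G.edgeFinset.card) fun G _ => by
      rw [Finset.mem_range, Nat.lt_succ_iff]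
      exact (card_edgeFinset_le G).trans (Nat.choose_le_pow n 2)]
  refine Finset.sum_le_sum fun E _ => ?_
  rw [← Finset.sum_fiberwise_of_maps_to
    (t := (Fintype.piFinset (fun _ : Fin n => Finset.range n)).filter
      fun d => ∑ v, d v = 2 * E ∧ d ∈ T)
    (g := fun (G : SimpleGraph (Fin n)) v => G.degree v) fun G hG => by
      simp only [Finset.mem_filter, Finset.mem_univ, true_and] at hG
      simp only [Finset.mem_filter, Fintype.mem_piFinset, Finset.mem_range]
      refine ⟨fun v => by simpa using G.degree_lt_card_verts v, ?_, hG.1⟩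
      rw [G.sum_degrees_eq_twice_card_edges, hG.2], Finset.mul_sum]
  refine Finset.sum_le_sum fun d hd => ?_
  have hdE := (Finset.mem_filter.1 hd).2.1
  have hc : 0 ≤ x ^ E * ∏ v, (w (d v) / (d v).factorial) :=
    mul_nonneg (pow_nonneg hx _) (Finset.prod_nonneg fun _ _ => div_nonneg (hw _) (by positivity))
  calc _ = ∑ G ∈ (((Finset.univ.filter fun G : SimpleGraph (Fin n) =>
          (fun v => G.degree v) ∈ T).filter fun G => G.edgeFinset.card = E).filter
            fun G => (fun v => G.degree v) = d),
          (x ^ E * ∏ v, (w (d v) / (d v).factorial)) * labelings d G := by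
        refine Finset.sum_congr rfl fun G hG => ?_
        simp only [Finset.mem_filter, Finset.mem_univ, true_and] at hG
        obtain ⟨⟨-, h2⟩, rfl⟩ := hG
        -- When `d` is the degree sequence of `G` itself, the number of labelings is `∏ (d v)!`,
        -- which cancels the denominators.
        rw [labelings_degree, mul_assoc, ← Finset.prod_mul_distrib, graphWeight, h2]
        congr 1
        refine Finset.prod_congr rfl fun v _ => ?_
        rw [div_mul_cancel₀]
        positivity
    _ = (x ^ E * ∏ v, (w (d v) / (d v).factorial)) * _ := (Finset.mul_sum _ _ _).symm
    _ ≤ (x ^ E * ∏ v, (w (d v) / (d v).factorial)) * labeledCount d E := by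
        refine mul_le_mul_of_nonneg_left ?_ hc
        refine Finset.sum_le_sum_of_subset_of_nonneg ?_ fun G _ _ => labelings_nonneg d G
        intro G hG
        simp only [Finset.mem_filter, Finset.mem_univ, true_and] at hG ⊢
        exact hG.1.2
    _ ≤ (x ^ E * ∏ v, (w (d v) / (d v).factorial)) * (2 ^ E * E.factorial) :=
        mul_le_mul_of_nonneg_left (labeledCount_le hdE) hc
    _ = _ := by rw [mul_pow]; ring

theorem factorial_le_mul_pow (E : ℕ) :
    (E.factorial : ℝ) ≤ Real.exp 1 * (E + 1) * ((E : ℝ) ^ E * Real.exp (-E)) := by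
  rcases Nat.eq_zero_or_pos E with rfl | hE
  · simp
  have key : (E.factorial : ℝ) ≤ Real.exp 1 * E * ((E : ℝ) ^ E * Real.exp (-E)) := by
    induction E, hE using Nat.le_induction with
    | base => simp [← Real.exp_add]
    | succ E hE ih =>
      have hE' : (0 : ℝ) < E := by exact_mod_cast hE
      have h1 : (1 - 1 / ((E + 1 : ℕ) : ℝ)) ^ (E + 1) ≤ Real.exp (-1) :=
        Real.one_sub_div_pow_le_exp_neg (by push_cast; linarith)
      have h2 : 1 - 1 / ((E + 1 : ℕ) : ℝ) = E / (E + 1) := by push_cast; field_simp; ring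
      rw [h2, div_pow, div_le_iff₀ (by positivity)] at h1
      rw [Nat.factorial_succ]
      push_cast
      calc ((E : ℝ) + 1) * E.factorial
          ≤ ((E : ℝ) + 1) * (Real.exp 1 * E * ((E : ℝ) ^ E * Real.exp (-E))) := by gcongr
        _ = ((E : ℝ) + 1) * Real.exp 1 * Real.exp (-E) * (E : ℝ) ^ (E + 1) := by ring
        _ ≤ ((E : ℝ) + 1) * Real.exp 1 * Real.exp (-E) *
              (Real.exp (-1) * ((E : ℝ) + 1) ^ (E + 1)) := by gcongr
        _ = _ := by
          rw [show -((E : ℝ) + 1) = -E + -1 by ring, Real.exp_add]; ring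
  refine key.trans ?_
  gcongr
  linarith

/-- Lower bound for the sum over graphs with monotone weights. -/
theorem le_sum_graphWeight {n : ℕ} (hn : 1 ≤ n) {x : ℝ} (hx : 0 < x) {w : ℕ → ℝ}
    (hw : ∀ i, 0 ≤ w i) (hanti : Antitone w) {θ : ℝ} (hθ : 0 ≤ θ) (D : ℕ) :
    (∑ j ∈ Finset.range (D + 1), w j * θ ^ j / j.factorial) ^ n * Real.exp (-(θ ^ 2 / (2 * x))) ≤
      max 1 θ ^ (D + D ^ 2 + 1) * (n : ℝ) ^ (D + D ^ 2 + 1) * Real.exp (D + 1) *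
        ∑ G : SimpleGraph (Fin n), graphWeight x w G := by
  classical
  set c := D + D ^ 2 with hc
  have hn0 : (0 : ℝ) < n := by exact_mod_cast hn
  set P := Fintype.piFinset (fun _ : Fin n => Finset.range (D + 1)) with hP
  -- With this edge number at most `c + 1` labels stay unused: `c` or `c + 1` by parity, or fewer
  -- when truncation makes `J d` zero.
  set J : (Fin n → ℕ) → ℕ := fun d => (∑ v, d v - c) / 2 with hJ
  have hmem : ∀ d ∈ P, ∀ v, d v ≤ D := fun d hd v =>
    Nat.lt_succ_iff.1 (Finset.mem_range.1 (Fintype.mem_piFinset.1 hd v))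
  have step1 : ∀ d ∈ P, θ ^ (∑ v, d v) * Real.exp (-(θ ^ 2 / (2 * x))) ≤
      max 1 θ ^ (c + 1) * (x ^ J d * labeledCount d (J d)) := by
    intro d hd
    have h1 : (2 ^ J d * (J d).factorial : ℝ) ≤ labeledCount d (J d) := by
      rcases le_or_gt c (∑ v, d v) with h | h
      · exact le_labeledCount (hmem d hd) (by simp only [hJ]; omega)
      · have : J d = 0 := by simp only [hJ]; omega
        rw [this, labeledCount_zero]; simp
    -- One term of the exponential series is at most its sum. This holds for every `J d`, so `θ`
    -- need not be matched to the number of edges.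
    have h2 := Real.pow_div_factorial_le_exp (x := θ ^ 2 / (2 * x)) (by positivity) (J d)
    rw [div_le_iff₀ (by positivity), div_pow, div_le_iff₀ (by positivity)] at h2
    obtain ⟨t, ht, htc⟩ : ∃ t, ∑ v, d v = 2 * J d + t ∧ t ≤ c + 1 :=
      ⟨∑ v, d v - 2 * J d, by simp only [hJ]; omega, by simp only [hJ]; omega⟩
    have h3 : θ ^ t ≤ max 1 θ ^ (c + 1) :=
      (pow_le_pow_left₀ hθ (le_max_right _ _) t).trans (pow_le_pow_right₀ (le_max_left _ _) htc)
    have hm : (0 : ℝ) ≤ max 1 θ := zero_le_one.trans (le_max_left _ _)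
    rw [ht, pow_add, pow_mul]
    calc (θ ^ 2) ^ J d * θ ^ t * Real.exp (-(θ ^ 2 / (2 * x)))
        ≤ (Real.exp (θ ^ 2 / (2 * x)) * (J d).factorial * (2 * x) ^ J d) * max 1 θ ^ (c + 1) *
            Real.exp (-(θ ^ 2 / (2 * x))) := by gcongr
      _ = (Real.exp (θ ^ 2 / (2 * x)) * Real.exp (-(θ ^ 2 / (2 * x)))) *
            (max 1 θ ^ (c + 1) * (x ^ J d * (2 ^ J d * (J d).factorial))) := by
          rw [mul_pow]; ring
      _ ≤ _ := by
          rw [← Real.exp_add, add_neg_cancel, Real.exp_zero, one_mul]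
          gcongr
  -- A graph can arise from many sequences `d`, each exceeding its degrees by at most `c + 1` in
  -- total. Charging `1 / n` per disagreeing vertex costs a factor of at most `n ^ (c + 1)` and
  -- bounds the sum over all `d` by a constant.
  set r : ℕ → ℕ → ℝ := fun a b => if b = a then 1 else 1 / n with hr
  have hr0 : ∀ a b, 0 ≤ r a b := fun a b => by simp only [hr]; split_ifs <;> positivity
  have step2 : ∀ d ∈ P, (∏ v, (w (d v) / (d v).factorial)) * (x ^ J d * labeledCount d (J d)) ≤
      ∑ G : SimpleGraph (Fin n), graphWeight x w G *
        ((n : ℝ) ^ (c + 1) * ∏ v, r (G.degree v) (d v)) := by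
    intro d hd
    rw [labeledCount, Finset.mul_sum, Finset.mul_sum]
    refine (Finset.sum_le_sum fun G hG => ?_).trans
      (Finset.sum_le_sum_of_subset_of_nonneg (Finset.filter_subset _ _) fun G _ _ =>
        mul_nonneg (graphWeight_nonneg hx.le hw G)
          (mul_nonneg (by positivity) (Finset.prod_nonneg fun _ _ => hr0 _ _)))
    have hGJ := (Finset.mem_filter.1 hG).2
    have hwd : 0 ≤ ∏ v, (w (d v) / (d v).factorial) :=
      Finset.prod_nonneg fun _ _ => div_nonneg (hw _) (by positivity)
    by_cases hle : ∀ v, G.degree v ≤ d v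
    swap
    · have h0 : labelings d G = 0 := by
        by_contra h0
        exact hle (degree_le_of_labelings_ne_zero h0)
      rw [h0, mul_zero, mul_zero]
      exact mul_nonneg (graphWeight_nonneg hx.le hw G)
          (mul_nonneg (by positivity) (Finset.prod_nonneg fun _ _ => hr0 _ _))
    have h1 := labelings_le d G
    rw [if_pos hle] at h1
    have h2 : (1 : ℝ) ≤ (n : ℝ) ^ (c + 1) * ∏ v, r (G.degree v) (d v) := by
      have h3 : ∏ v, (1 / (n : ℝ)) ^ (d v - G.degree v) ≤ ∏ v, r (G.degree v) (d v) := by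
        refine Finset.prod_le_prod (fun _ _ => by positivity) fun v _ => ?_
        simp only [hr]
        split_ifs with h
        · simp [h]
        · refine pow_le_of_le_one (by positivity) ?_ ?_
          · rw [div_le_one hn0]; exact_mod_cast hn
          · have := hle v; omega
      rw [Finset.prod_pow_eq_pow_sum] at h3
      have h4 : ∑ v, (d v - G.degree v) ≤ c + 1 := by
        have h5 : ∑ v, (d v - G.degree v) + ∑ v, G.degree v = ∑ v, d v := by
          rw [← Finset.sum_add_distrib]
          exact Finset.sum_congr rfl fun v _ => Nat.sub_add_cancel (hle v)
        rw [G.sum_degrees_eq_twice_card_edges, hGJ] at h5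
        simp only [hJ] at h5
        omega
      calc (1 : ℝ) ≤ (n : ℝ) ^ (c + 1 - ∑ v, (d v - G.degree v)) :=
            one_le_pow₀ (by exact_mod_cast hn)
        _ = (n : ℝ) ^ (c + 1) * (1 / (n : ℝ)) ^ (∑ v, (d v - G.degree v)) := by
            rw [pow_sub₀ _ hn0.ne' h4, one_div, inv_pow]
        _ ≤ _ := by gcongr
    have h6 : (∏ v, (w (d v) / (d v).factorial)) * (∏ v, ((d v).factorial : ℝ)) ≤
        ∏ v, w (G.degree v) := by
      rw [← Finset.prod_mul_distrib]
      refine Finset.prod_le_prod (fun v _ => ?_) fun v _ => ?_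
      · exact mul_nonneg (div_nonneg (hw _) (by positivity)) (by positivity)
      · rw [div_mul_cancel₀ _ (by positivity)]
        -- Monotonicity enters here: the actual degree is at most the prescribed one, so its weight
        -- is no smaller.
        exact hanti (hle v)
    calc (∏ v, (w (d v) / (d v).factorial)) * (x ^ J d * labelings d G)
        = x ^ J d * ((∏ v, (w (d v) / (d v).factorial)) * labelings d G) := by ring
      _ ≤ x ^ J d * ((∏ v, (w (d v) / (d v).factorial)) * ∏ v, ((d v).factorial : ℝ)) := by
          gcongr
      _ ≤ x ^ J d * ∏ v, w (G.degree v) := by gcongr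
      _ = graphWeight x w G * 1 := by rw [graphWeight, hGJ, mul_one]
      _ ≤ _ := mul_le_mul_of_nonneg_left h2 (graphWeight_nonneg hx.le hw G)
  have step3 : ∀ G : SimpleGraph (Fin n), ∑ d ∈ P, ∏ v, r (G.degree v) (d v) ≤
      Real.exp (D + 1) := by
    intro G
    rw [hP, ← Finset.prod_univ_sum (fun _ : Fin n => Finset.range (D + 1))
      fun v b => r (G.degree v) b]
    have h1 : ∀ a, ∑ b ∈ Finset.range (D + 1), r a b ≤ 1 + ((D : ℝ) + 1) / n := by
      intro a
      calc ∑ b ∈ Finset.range (D + 1), r a b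
          ≤ ∑ b ∈ Finset.range (D + 1), ((if b = a then 1 else 0) + 1 / (n : ℝ)) := by
            refine Finset.sum_le_sum fun b _ => ?_
            simp only [hr]
            split_ifs
            · have : (0 : ℝ) ≤ 1 / n := by positivity
              linarith
            · simp
        _ ≤ _ := by
            rw [Finset.sum_add_distrib, Finset.sum_const, Finset.card_range, Finset.sum_ite_eq',
              nsmul_eq_mul]
            push_cast
            rw [mul_one_div]
            gcongr
            split_ifs <;> simp
    calc ∏ v, ∑ b ∈ Finset.range (D + 1), r (G.degree v) b
        ≤ ∏ _v : Fin n, Real.exp (((D : ℝ) + 1) / n) :=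
          Finset.prod_le_prod (fun v _ => Finset.sum_nonneg fun _ _ => hr0 _ _) fun v _ =>
            (h1 _).trans ((add_comm _ _).trans_le (Real.add_one_le_exp _))
      _ = Real.exp (D + 1) := by
          rw [Finset.prod_const, Finset.card_univ, Fintype.card_fin, ← Real.exp_nat_mul]
          congr 1
          field_simp
  have hm : (0 : ℝ) ≤ max 1 θ := zero_le_one.trans (le_max_left _ _)
  have hpow : (∑ j ∈ Finset.range (D + 1), w j * θ ^ j / j.factorial) ^ n =
      ∑ d ∈ P, (∏ v, (w (d v) / (d v).factorial)) * θ ^ (∑ v, d v) := by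
    have h1 := Finset.prod_univ_sum (fun _ : Fin n => Finset.range (D + 1))
      fun _ j => w j * θ ^ j / j.factorial
    rw [Finset.prod_const, Finset.card_univ, Fintype.card_fin] at h1
    rw [h1]
    refine Finset.sum_congr rfl fun d _ => ?_
    rw [← Finset.prod_pow_eq_pow_sum, ← Finset.prod_mul_distrib]
    exact Finset.prod_congr rfl fun v _ => by ring
  calc _ = ∑ d ∈ P, (∏ v, (w (d v) / (d v).factorial)) *
          (θ ^ (∑ v, d v) * Real.exp (-(θ ^ 2 / (2 * x)))) := by
        rw [hpow, Finset.sum_mul]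
        exact Finset.sum_congr rfl fun d _ => by ring
    _ ≤ ∑ d ∈ P, max 1 θ ^ (c + 1) * ∑ G : SimpleGraph (Fin n), graphWeight x w G *
        ((n : ℝ) ^ (c + 1) * ∏ v, r (G.degree v) (d v)) := by
        refine Finset.sum_le_sum fun d hd => ?_
        refine (mul_le_mul_of_nonneg_left (step1 d hd)
          (Finset.prod_nonneg fun _ _ => div_nonneg (hw _) (by positivity))).trans ?_
        rw [mul_left_comm]
        exact mul_le_mul_of_nonneg_left (step2 d hd) (by positivity)
    _ = max 1 θ ^ (c + 1) * (n : ℝ) ^ (c + 1) * ∑ G : SimpleGraph (Fin n),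
          graphWeight x w G * ∑ d ∈ P, ∏ v, r (G.degree v) (d v) := by
        rw [← Finset.mul_sum, Finset.sum_comm, mul_assoc]
        congr 1
        rw [Finset.mul_sum]
        refine Finset.sum_congr rfl fun G _ => ?_
        rw [← Finset.mul_sum, ← Finset.mul_sum]
        ring
    _ ≤ max 1 θ ^ (c + 1) * (n : ℝ) ^ (c + 1) * ∑ G : SimpleGraph (Fin n),
          graphWeight x w G * Real.exp (D + 1) := by
        refine mul_le_mul_of_nonneg_left ?_ (by positivity)
        exact Finset.sum_le_sum fun G _ =>
          mul_le_mul_of_nonneg_left (step3 G) (graphWeight_nonneg hx.le hw G)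
    _ = _ := by rw [← Finset.sum_mul]; ring

end GraphCounting

/-! ### The exponential family and the dual rate function. -/

/-- `∑ θ ^ i e ^ (f i) / i!`. -/
noncomputable def pgf (f : ℕ → ℝ) (θ : ℝ≥0) : ℝ :=
  ∑' i : ℕ, 1 / (Nat.factorial i : ℝ) * (θ : ℝ) ^ i * Real.exp (f i)

theorem logNorm_eq (f : ℕ → ℝ) (θ : ℝ≥0) : logNorm f θ = Real.log (pgf f θ) := rfl

theorem one_le_pgf {f : ℕ → ℝ} (hf : f ∈ classF) (θ : ℝ≥0) : 1 ≤ pgf f θ := by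
  have h := (summable_weight hf θ).le_tsum 0 fun i _ => by positivity
  rw [pgf]
  simpa [hf.1] using h

theorem pgf_pos {f : ℕ → ℝ} (hf : f ∈ classF) (θ : ℝ≥0) : 0 < pgf f θ :=
  zero_lt_one.trans_le (one_le_pgf hf θ)

theorem exp_logNorm {f : ℕ → ℝ} (hf : f ∈ classF) (θ : ℝ≥0) :
    Real.exp (logNorm f θ) = pgf f θ := Real.exp_log (pgf_pos hf θ)

theorem pgf_zero {f : ℕ → ℝ} (hf : f ∈ classF) : pgf f 0 = 1 := by
  rw [pgf, tsum_eq_single 0 fun i hi => by simp [hi]]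
  simp [hf.1]

theorem logNorm_zero {f : ℕ → ℝ} (hf : f ∈ classF) : logNorm f 0 = 0 := by
  rw [logNorm_eq, pgf_zero hf, Real.log_one]

theorem hasSum_exp_nnreal (θ : ℝ≥0) :
    HasSum (fun i : ℕ => 1 / (Nat.factorial i : ℝ) * (θ : ℝ) ^ i) (Real.exp θ) := by
  have h := NormedSpace.expSeries_div_hasSum_exp (θ : ℝ)
  rw [← Real.exp_eq_exp_ℝ] at h
  exact h.congr_fun fun i => by ring

theorem logNorm_le {f : ℕ → ℝ} (hf : f ∈ classF) (hneg : ∀ i, f i ≤ 0) (θ : ℝ≥0) :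
    logNorm f θ ≤ θ := by
  rw [logNorm_eq, Real.log_le_iff_le_exp (pgf_pos hf θ)]
  refine hasSum_le (fun i => ?_) (summable_weight hf θ).hasSum (hasSum_exp_nnreal θ)
  exact mul_le_of_le_one_right (by positivity) (Real.exp_le_one_iff.2 (hneg i))

theorem continuous_pgf {f : ℕ → ℝ} (hf : f ∈ classF) : Continuous (pgf f) := by
  rw [continuous_iff_continuousAt]
  intro θ
  have h : ContinuousOn (pgf f) (Set.Iio (θ + 1)) := by
    refine continuousOn_tsum (u := fun i : ℕ =>
      1 / (Nat.factorial i : ℝ) * ((θ + 1 : ℝ≥0) : ℝ) ^ i * Real.exp (f i)) (fun i => ?_)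
      (summable_weight hf (θ + 1)) fun i t ht => ?_
    · fun_prop
    · rw [Real.norm_of_nonneg (by positivity)]
      have : (t : ℝ) ≤ ((θ + 1 : ℝ≥0) : ℝ) := NNReal.coe_le_coe.2 (le_of_lt ht)
      gcongr
  exact h.continuousAt (Iio_mem_nhds (by simp))

theorem continuous_logNorm {f : ℕ → ℝ} (hf : f ∈ classF) : Continuous (logNorm f) :=
  (continuous_pgf hf).log fun θ => (pgf_pos hf θ).ne'

theorem continuous_sigma_mass {f : ℕ → ℝ} (hf : f ∈ classF) (i : ℕ) :
    Continuous fun θ => (sigma f hf θ).mass i := by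
  have h := continuous_logNorm hf
  change Continuous fun θ : ℝ≥0 => Real.exp (-logNorm f θ) *
    (1 / (Nat.factorial i : ℝ) * (θ : ℝ) ^ i * Real.exp (f i))
  fun_prop

/-- The function of `θ` whose minimum is the limit of `-(1 / n) log Z_n`. -/
noncomputable def dualRate (β : ℝ) (f : ℕ → ℝ) (θ : ℝ≥0) : ℝ :=
  (θ : ℝ) ^ 2 / (2 * β) + β / 2 - logNorm f θ

theorem continuous_dualRate {f : ℕ → ℝ} (hf : f ∈ classF) (β : ℝ) :
    Continuous (dualRate β f) := by
  have h := continuous_logNorm hf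
  unfold dualRate
  fun_prop

theorem dualRate_zero {f : ℕ → ℝ} (hf : f ∈ classF) (β : ℝ) : dualRate β f 0 = β / 2 := by
  simp [dualRate, logNorm_zero hf]

/-- Coercivity: beyond `2 * β` the quadratic term dominates `logNorm f θ ≤ θ`, which confines the
minimization to a compact interval. -/
theorem le_dualRate_of_le {f : ℕ → ℝ} (hf : f ∈ classF) (hneg : ∀ i, f i ≤ 0) {β : ℝ}
    (hβ : 0 < β) {θ : ℝ≥0} (hθ : 2 * β ≤ θ) : β / 2 ≤ dualRate β f θ := by
  have h := logNorm_le hf hneg θ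
  have h2 : (θ : ℝ) ≤ (θ : ℝ) ^ 2 / (2 * β) := by
    rw [le_div_iff₀ (by positivity), sq]
    exact mul_le_mul_of_nonneg_left hθ θ.2
  rw [dualRate]
  linarith

/-- Completing the square gives `(θ - β)² / (2β) + (θ - logNorm f θ)`. For `θ > 0` the last
difference is strictly positive, by comparison with the series of `exp θ`. -/
theorem dualRate_pos {f : ℕ → ℝ} (hf : f ∈ classF) (hneg : ∀ i, f i ≤ 0) (hlt : ∃ i, f i < 0)
    {β : ℝ} (hβ : 0 < β) (θ : ℝ≥0) : 0 < dualRate β f θ := by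
  rcases eq_or_ne θ 0 with rfl | hθ
  · rw [dualRate_zero hf]; linarith
  have hθ' : (0 : ℝ) < θ := by positivity
  obtain ⟨i, hi⟩ := hlt
  have h1 : logNorm f θ < θ := by
    rw [logNorm_eq, Real.log_lt_iff_lt_exp (pgf_pos hf θ)]
    refine hasSum_lt (i := i) (fun i => ?_) ?_ (summable_weight hf θ).hasSum (hasSum_exp_nnreal θ)
    · exact mul_le_of_le_one_right (by positivity) (Real.exp_le_one_iff.2 (hneg i))
    · exact mul_lt_of_lt_one_right (by positivity) (Real.exp_lt_one_iff.2 hi)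
  have h2 : dualRate β f θ = ((θ : ℝ) - β) ^ 2 / (2 * β) + (θ - logNorm f θ) := by
    rw [dualRate]; field_simp; ring
  rw [h2]
  have : 0 ≤ ((θ : ℝ) - β) ^ 2 / (2 * β) := by positivity
  linarith

/-- Near zero `logNorm` grows at least linearly, through the terms of index 0 and 1, and beats the
quadratic term. Hence zero is not a minimizer. -/
theorem exists_dualRate_lt {f : ℕ → ℝ} (hf : f ∈ classF) {β : ℝ} (hβ : 0 < β) :
    ∃ θ : ℝ≥0, dualRate β f θ < β / 2 := by
  have hw := Real.exp_pos (f 1)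
  set w := Real.exp (f 1) with hwdef
  obtain ⟨t, ht0, ht⟩ : ∃ t : ℝ, 0 < t ∧ t * (1 + t * w) < 2 * β * w := by
    refine ⟨min 1 (β * w / (1 + w)), by positivity, ?_⟩
    have h1 : min 1 (β * w / (1 + w)) ≤ 1 := min_le_left _ _
    have h2 : min 1 (β * w / (1 + w)) ≤ β * w / (1 + w) := min_le_right _ _
    have h3 : 0 < min 1 (β * w / (1 + w)) := by positivity
    generalize min 1 (β * w / (1 + w)) = t at h1 h2 h3
    rw [le_div_iff₀ (by positivity)] at h2
    have h4 : t * w ≤ w := by nlinarith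
    have : 0 < β * w := by positivity
    nlinarith
  lift t to ℝ≥0 using ht0.le
  refine ⟨t, ?_⟩
  have h1 : 1 + (t : ℝ) * w ≤ pgf f t := by
    have h := (summable_weight hf t).sum_le_tsum (Finset.range 2) fun i _ => by positivity
    simp only [Finset.sum_range_succ, Finset.sum_range_zero] at h
    rw [pgf]
    simpa [hf.1, ← hwdef] using h
  have h2 : 1 - (1 + (t : ℝ) * w)⁻¹ ≤ logNorm f t :=
    (Real.one_sub_inv_le_log_of_pos (by positivity)).trans
      (Real.log_le_log (by positivity) h1)
  have h3 : (t : ℝ) ^ 2 / (2 * β) < 1 - (1 + t * w)⁻¹ := by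
    have : 1 - (1 + t * w)⁻¹ = t * w / (1 + t * w) := by field_simp; ring
    rw [this, div_lt_div_iff₀ (by positivity) (by positivity)]
    nlinarith
  rw [dualRate]
  linarith

theorem exists_isMin_dualRate {f : ℕ → ℝ} (hf : f ∈ classF) (hneg : ∀ i, f i ≤ 0) {β : ℝ}
    (hβ : 0 < β) : ∃ θ₀ : ℝ≥0, 0 < θ₀ ∧ dualRate β f θ₀ < β / 2 ∧
      ∀ θ, dualRate β f θ₀ ≤ dualRate β f θ := by
  obtain ⟨θ₀, -, hmin⟩ := (isCompact_Icc (a := (0 : ℝ≥0)) (b := (2 * β).toNNReal)).exists_isMinOn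
    ⟨0, by simp⟩ (continuous_dualRate hf β).continuousOn
  have h0 : dualRate β f θ₀ ≤ β / 2 := by
    rw [← dualRate_zero hf]
    exact hmin (by simp)
  have hall : ∀ θ, dualRate β f θ₀ ≤ dualRate β f θ := by
    intro θ
    rcases le_total (θ : ℝ) (2 * β) with h | h
    · exact hmin ⟨zero_le, NNReal.le_toNNReal_of_coe_le h⟩
    · exact h0.trans (le_dualRate_of_le hf hneg hβ h)
  obtain ⟨t, ht⟩ := exists_dualRate_lt hf hβ
  have hlt := (hall t).trans_lt ht
  refine ⟨θ₀, ?_, hlt, hall⟩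
  rw [pos_iff_ne_zero]
  rintro rfl
  rw [dualRate_zero hf] at hlt
  exact lt_irrefl _ hlt

/-! ### Free energy and relative entropy. -/

theorem mean_hasSum (μ : FiniteMeanLaw) :
    HasSum (fun i : ℕ => (i : ℝ) * μ.mass i) μ.mean := μ.summable_mean.hasSum

theorem mean_nonneg (μ : FiniteMeanLaw) : 0 ≤ μ.mean :=
  tsum_nonneg fun i => mul_nonneg (Nat.cast_nonneg i) (μ.nonneg i)

theorem mass_eq_of_mean_eq_zero {μ : FiniteMeanLaw} (h : μ.mean = 0) (i : ℕ) :
    μ.mass i = if i = 0 then 1 else 0 := by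
  have h1 := mean_hasSum μ
  rw [h, hasSum_zero_iff_of_nonneg fun i => mul_nonneg (Nat.cast_nonneg i) (μ.nonneg i)] at h1
  have h2 : ∀ j, j ≠ 0 → μ.mass j = 0 := fun j hj => by
    simpa [hj] using congrFun h1 j
  split_ifs with hi
  · rw [hi]
    exact (hasSum_single 0 h2).unique μ.hasSum_one
  · exact h2 i hi

theorem sigma_zero_mass {f : ℕ → ℝ} (hf : f ∈ classF) (i : ℕ) :
    (sigma f hf 0).mass i = if i = 0 then 1 else 0 := by
  simp only [sigma, logNorm_zero hf]
  split_ifs with h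
  · simp [h, hf.1]
  · simp [h]

theorem sigma_mass_pos {f : ℕ → ℝ} (hf : f ∈ classF) {θ : ℝ≥0} (hθ : 0 < θ) (i : ℕ) :
    0 < (sigma f hf θ).mass i := by
  have : (0 : ℝ) < θ := hθ
  simp only [sigma]
  positivity

theorem sigma_mean_pos {f : ℕ → ℝ} (hf : f ∈ classF) {θ : ℝ≥0} (hθ : 0 < θ) :
    0 < (sigma f hf θ).mean :=
  (sigma f hf θ).summable_mean.tsum_pos
    (fun i => mul_nonneg (Nat.cast_nonneg i) ((sigma f hf θ).nonneg i)) 1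
    (by simpa using sigma_mass_pos hf hθ 1)

theorem log_factorial_mul_sigma_mass {f : ℕ → ℝ} (hf : f ∈ classF) {θ : ℝ≥0} (hθ : 0 < θ)
    (i : ℕ) : Real.log ((i.factorial : ℝ) * (sigma f hf θ).mass i) =
      -logNorm f θ + i * Real.log θ + f i := by
  have hθ' : (0 : ℝ) < θ := hθ
  have h : (i.factorial : ℝ) * (sigma f hf θ).mass i =
      Real.exp (-logNorm f θ) * (θ : ℝ) ^ i * Real.exp (f i) := by
    simp only [sigma]
    field_simp
  rw [h, Real.log_mul (by positivity) (by positivity), Real.log_mul (by positivity) (by positivity),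
    Real.log_exp, Real.log_exp, Real.log_pow]

theorem sub_le_mul_log_div {a b : ℝ} (ha : 0 ≤ a) (hb : 0 < b) : a - b ≤ a * Real.log (a / b) := by
  rcases ha.eq_or_lt with rfl | ha
  · simpa using hb.le
  have h := mul_le_mul_of_nonneg_left (Real.one_sub_inv_le_log_of_pos (div_pos ha hb)) ha.le
  refine le_trans (le_of_eq ?_) h
  field_simp

theorem eq_of_mul_log_div_eq {a b : ℝ} (ha : 0 ≤ a) (hb : 0 < b)
    (h : a * Real.log (a / b) = a - b) : a = b := by
  rcases ha.eq_or_lt with rfl | ha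
  · simp at h; linarith
  by_contra hne
  have h1 : b / a ≠ 1 := fun h1 => hne ((div_eq_one_iff_eq ha.ne').1 h1).symm
  have h2 := Real.log_lt_sub_one_of_pos (div_pos hb ha) h1
  rw [← inv_div, Real.log_inv] at h2
  have h3 := mul_lt_mul_of_pos_left h2 ha
  have h4 : a * ((a / b)⁻¹ - 1) = b - a := by field_simp
  rw [h4] at h3
  linarith

/-- The integrability under which the free energy of `μ` is finite. -/
structure FiniteEnergy (f : ℕ → ℝ) (μ : FiniteMeanLaw) : Prop where
  entropy : Summable fun i => μ.mass i * Real.log ((Nat.factorial i : ℝ) * μ.mass i)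
  energy : Summable fun i => μ.mass i * f i

/-- `I(μ) - μ(f)` as a real number. -/
noncomputable def freeEnergy (β : ℝ) (f : ℕ → ℝ) (μ : FiniteMeanLaw) : ℝ :=
  ∑' i, μ.mass i * Real.log ((Nat.factorial i : ℝ) * μ.mass i) - ∑' i, μ.mass i * f i +
    (-(μ.mean / 2) * Real.log (μ.mean * β) + (μ.mean + β) / 2)

theorem freeEnergy_of_mean_eq_zero {f : ℕ → ℝ} (hf : f ∈ classF) {β : ℝ} {μ : FiniteMeanLaw}
    (h : μ.mean = 0) : freeEnergy β f μ = β / 2 := by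
  have h1 := mass_eq_of_mean_eq_zero h
  rw [freeEnergy, tsum_eq_single 0 fun i hi => by simp [h1, hi],
    tsum_eq_single 0 fun i hi => by simp [h1, hi]]
  simp [h1, h, hf.1]

/-- The parameter `θ` with `θ ^ 2 = β * mean μ`. -/
noncomputable def meanParam (β : ℝ) (μ : FiniteMeanLaw) : ℝ≥0 := (Real.sqrt (β * μ.mean)).toNNReal

theorem coe_meanParam_sq {β : ℝ} (hβ : 0 < β) (μ : FiniteMeanLaw) :
    (meanParam β μ : ℝ) ^ 2 = β * μ.mean := by
  rw [meanParam, Real.coe_toNNReal _ (Real.sqrt_nonneg _),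
    Real.sq_sqrt (mul_nonneg hβ.le (mean_nonneg μ))]

/-- The difference of the two sides is the relative entropy of `μ` with respect to `sigma f hf θ`:
the choice `θ² = β * mean μ` makes the logarithmic mean terms cancel. Mean zero is separate, since
then `sigma` has zero masses. -/
theorem dualRate_meanParam_le {f : ℕ → ℝ} (hf : f ∈ classF) {β : ℝ} (hβ : 0 < β)
    {μ : FiniteMeanLaw} (hμ : FiniteEnergy f μ) :
    dualRate β f (meanParam β μ) ≤ freeEnergy β f μ ∧
      (freeEnergy β f μ = dualRate β f (meanParam β μ) → μ = sigma f hf (meanParam β μ)) := by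
  have hsq := coe_meanParam_sq hβ μ
  rcases (mean_nonneg μ).eq_or_lt with hm | hm
  · have h0 : meanParam β μ = 0 := by
      rw [← hm, mul_zero] at hsq
      exact_mod_cast pow_eq_zero_iff two_ne_zero |>.1 hsq
    rw [freeEnergy_of_mean_eq_zero hf hm.symm, h0, dualRate_zero hf]
    refine ⟨le_rfl, fun _ => ?_⟩
    ext i
    rw [mass_eq_of_mean_eq_zero hm.symm, sigma_zero_mass]
  generalize meanParam β μ = θ at hsq
  have hθ' : (0 : ℝ) < θ := by
    have : 0 < β * μ.mean := mul_pos hβ hm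
    rw [← hsq] at this
    exact θ.coe_nonneg.lt_of_ne fun h => by rw [← h] at this; simp at this
  have hθ : 0 < θ := hθ'
  have hσ := sigma_mass_pos hf hθ
  have hlog : μ.mean * Real.log θ = μ.mean / 2 * Real.log (μ.mean * β) := by
    rw [mul_comm μ.mean β, ← hsq, Real.log_pow]; push_cast; ring
  have hterm : ∀ i, μ.mass i * Real.log (μ.mass i / (sigma f hf θ).mass i) =
      μ.mass i * Real.log ((Nat.factorial i : ℝ) * μ.mass i) - μ.mass i * f i -
        (i * μ.mass i) * Real.log θ + μ.mass i * logNorm f θ := by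
    intro i
    rcases (μ.nonneg i).eq_or_lt with h | h
    · simp [← h]
    · have h1 := log_factorial_mul_sigma_mass hf hθ i
      rw [Real.log_mul (by positivity) (hσ i).ne'] at h1
      rw [Real.log_div h.ne' (hσ i).ne', Real.log_mul (by positivity) h.ne']
      linear_combination (-μ.mass i) * h1
  -- The subtracted differences of masses sum to zero and make each term nonnegative, so a vanishing
  -- sum forces equality mass by mass.
  have hsum : HasSum (fun i => μ.mass i * Real.log (μ.mass i / (sigma f hf θ).mass i) -
      (μ.mass i - (sigma f hf θ).mass i)) (freeEnergy β f μ - dualRate β f θ) := by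
    have h1 := (((hμ.entropy.hasSum.sub hμ.energy.hasSum).sub
      ((mean_hasSum μ).mul_right (Real.log θ))).add (μ.hasSum_one.mul_right (logNorm f θ))).sub
      (μ.hasSum_one.sub (sigma f hf θ).hasSum_one)
    have hval : freeEnergy β f μ - dualRate β f θ =
        ∑' i, μ.mass i * Real.log ((Nat.factorial i : ℝ) * μ.mass i) - ∑' i, μ.mass i * f i -
          μ.mean * Real.log θ + 1 * logNorm f θ - (1 - 1) := by
      rw [freeEnergy, dualRate, hlog, hsq]
      field_simp
      ring
    rw [hval]
    exact h1.congr_fun fun i => by rw [hterm]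
  have hnn : ∀ i, 0 ≤ μ.mass i * Real.log (μ.mass i / (sigma f hf θ).mass i) -
      (μ.mass i - (sigma f hf θ).mass i) := fun i =>
    sub_nonneg.2 (sub_le_mul_log_div (μ.nonneg i) (hσ i))
  refine ⟨sub_nonneg.1 (hsum.nonneg hnn), fun heq => ?_⟩
  rw [heq, sub_self, hasSum_zero_iff_of_nonneg hnn] at hsum
  ext i
  exact eq_of_mul_log_div_eq (μ.nonneg i) (hσ i) (sub_eq_zero.1 (congrFun hsum i))

/-- Since `e^x |x| ≤ 1` for `x ≤ 0`, the factor `e^(f i)` in the mass controls `f i`, however fast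
`f` decreases. -/
theorem summable_sigma_mul {f : ℕ → ℝ} (hf : f ∈ classF) (hneg : ∀ i, f i ≤ 0) (θ : ℝ≥0) :
    Summable fun i => (sigma f hf θ).mass i * f i := by
  refine Summable.of_norm_bounded
    (g := fun i => Real.exp (-logNorm f θ) * (1 / (Nat.factorial i : ℝ) * (θ : ℝ) ^ i))
    ((hasSum_exp_nnreal θ).summable.mul_left _) fun i => ?_
  have h1 : Real.exp (f i) * |f i| ≤ 1 := by
    rw [abs_of_nonpos (hneg i)]
    have h2 := Real.add_one_le_exp (-f i)
    have h3 : Real.exp (f i) * Real.exp (-f i) = 1 := by rw [← Real.exp_add]; simp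
    have h4 := mul_le_mul_of_nonneg_left h2 (Real.exp_pos (f i)).le
    nlinarith [Real.exp_pos (f i)]
  have h5 : 0 ≤ (sigma f hf θ).mass i := (sigma f hf θ).nonneg i
  rw [norm_mul, Real.norm_of_nonneg h5, Real.norm_eq_abs]
  calc (sigma f hf θ).mass i * |f i| = Real.exp (-logNorm f θ) *
        (1 / (Nat.factorial i : ℝ) * (θ : ℝ) ^ i) * (Real.exp (f i) * |f i|) := by
        simp only [sigma]; ring
    _ ≤ _ := mul_le_of_le_one_right (by positivity) h1

theorem entropy_sigma {f : ℕ → ℝ} (hf : f ∈ classF) (hneg : ∀ i, f i ≤ 0) {θ : ℝ≥0}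
    (hθ : 0 < θ) :
    HasSum (fun i => (sigma f hf θ).mass i *
      Real.log ((Nat.factorial i : ℝ) * (sigma f hf θ).mass i))
      (-logNorm f θ + (sigma f hf θ).mean * Real.log θ + ∑' i, (sigma f hf θ).mass i * f i) := by
  have h := (((sigma f hf θ).hasSum_one.mul_right (-logNorm f θ)).add
    ((mean_hasSum (sigma f hf θ)).mul_right (Real.log θ))).add
      (summable_sigma_mul hf hneg θ).hasSum
  rw [one_mul] at h
  refine h.congr_fun fun i => ?_
  rw [log_factorial_mul_sigma_mass hf hθ]
  ring

theorem finiteEnergy_sigma {f : ℕ → ℝ} (hf : f ∈ classF) (hneg : ∀ i, f i ≤ 0) (θ : ℝ≥0) :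
    FiniteEnergy f (sigma f hf θ) := by
  refine ⟨?_, summable_sigma_mul hf hneg θ⟩
  rcases eq_or_ne θ 0 with rfl | hθ
  · exact summable_of_ne_finset_zero (s := {0}) fun i hi => by
      rw [sigma_zero_mass, if_neg (by simpa using hi), zero_mul]
  · exact (entropy_sigma hf hneg (pos_iff_ne_zero.2 hθ)).summable

/-- For `θ > 0` this is `log y ≤ y - 1` at `y = θ² / (β m)`, with `m` the mean of `sigma f hf θ`. -/
theorem freeEnergy_sigma_le {f : ℕ → ℝ} (hf : f ∈ classF) (hneg : ∀ i, f i ≤ 0) {β : ℝ}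
    (hβ : 0 < β) (θ : ℝ≥0) : freeEnergy β f (sigma f hf θ) ≤ dualRate β f θ := by
  rcases eq_or_ne θ 0 with rfl | hθ
  · rw [dualRate_zero hf, freeEnergy_of_mean_eq_zero hf]
    simp [FiniteMeanLaw.mean, sigma_zero_mass]
  rw [← pos_iff_ne_zero] at hθ
  have hθ' : (0 : ℝ) < θ := hθ
  have hm := sigma_mean_pos hf hθ
  rw [freeEnergy, (entropy_sigma hf hneg hθ).tsum_eq, dualRate]
  generalize (sigma f hf θ).mean = m at hm
  have h1 := Real.log_le_sub_one_of_pos (x := (θ : ℝ) ^ 2 / (m * β)) (by positivity)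
  rw [Real.log_div (by positivity) (by positivity), Real.log_pow] at h1
  have h2 := mul_le_mul_of_nonneg_left h1 (half_pos hm).le
  have h3 : m / 2 * ((θ : ℝ) ^ 2 / (m * β) - 1) = (θ : ℝ) ^ 2 / (2 * β) - m / 2 := by field_simp
  rw [h3] at h2
  push_cast at h2
  linarith

/-- Stationarity without derivatives: otherwise `log y < y - 1` is strict, and passing from `θ` to
the parameter matched to the mean of `sigma f hf θ` would lower `dualRate`. -/
theorem sq_eq_of_isMin {f : ℕ → ℝ} (hf : f ∈ classF) (hneg : ∀ i, f i ≤ 0) {β : ℝ}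
    (hβ : 0 < β) {θ : ℝ≥0} (hθ : 0 < θ) (hmin : ∀ t, dualRate β f θ ≤ dualRate β f t) :
    (θ : ℝ) ^ 2 = β * (sigma f hf θ).mean := by
  have hθ' : (0 : ℝ) < θ := hθ
  have hm := sigma_mean_pos hf hθ
  by_contra hne
  have h1 := (hmin _).trans (dualRate_meanParam_le hf hβ (finiteEnergy_sigma hf hneg θ)).1
  rw [freeEnergy, (entropy_sigma hf hneg hθ).tsum_eq, dualRate] at h1
  generalize (sigma f hf θ).mean = m at hm hne h1
  have h4 : (θ : ℝ) ^ 2 / (m * β) ≠ 1 := by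
    rw [Ne, div_eq_one_iff_eq (by positivity)]
    rwa [mul_comm]
  have h1' := Real.log_lt_sub_one_of_pos (x := (θ : ℝ) ^ 2 / (m * β)) (by positivity) h4
  rw [Real.log_div (by positivity) (by positivity), Real.log_pow] at h1'
  have h2 := mul_lt_mul_of_pos_left h1' (half_pos hm)
  have h3 : m / 2 * ((θ : ℝ) ^ 2 / (m * β) - 1) = (θ : ℝ) ^ 2 / (2 * β) - m / 2 := by field_simp
  rw [h3] at h2
  push_cast at h2
  linarith

/-! ### Uniqueness of the stationary parameter. -/

/-- Stationarity multiplied by `pgf f θ` and ordered by powers of `θ`; the linear term of the mean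
series is isolated on the right. -/
theorem hasSum_of_sq_eq {f : ℕ → ℝ} (hf : f ∈ classF) {β : ℝ} {θ : ℝ≥0}
    (h : (θ : ℝ) ^ 2 = β * (sigma f hf θ).mean) :
    HasSum (fun j : ℕ => (θ : ℝ) ^ (j + 2) * (Real.exp (f j) / j.factorial -
      β * (Real.exp (f (j + 2)) / (j + 1).factorial))) (β * θ * Real.exp (f 1)) := by
  have h0 := (sigma f hf θ).hasSum_one.mul_left ((θ : ℝ) ^ 2)
  have h1 := (((hasSum_nat_add_iff' 2).2 (mean_hasSum (sigma f hf θ)))).mul_left β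
  have h2 := (h0.sub h1).mul_left (Real.exp (logNorm f θ))
  have he : Real.exp (logNorm f θ) * Real.exp (-logNorm f θ) = 1 := by
    rw [← Real.exp_add]; simp
  have hval : β * θ * Real.exp (f 1) = Real.exp (logNorm f θ) * ((θ : ℝ) ^ 2 * 1 -
      β * ((sigma f hf θ).mean - ∑ i ∈ Finset.range 2, (i : ℝ) * (sigma f hf θ).mass i)) := by
    simp only [Finset.sum_range_succ, Finset.sum_range_zero]
    rw [mul_sub β, ← h]
    simp only [sigma]
    simp
    linear_combination (-β * θ * Real.exp (f 1)) * he
  rw [hval]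
  refine h2.congr_fun fun j => ?_
  · simp only [sigma]
    have h3 : ((j + 2).factorial : ℝ) = ((j : ℝ) + 2) * (j + 1).factorial := by
      rw [Nat.factorial_succ]; push_cast; ring
    rw [h3]
    push_cast
    have h4 : ((j : ℝ) + 2) ≠ 0 := by positivity
    field_simp
    rw [he]
    ring

/-- The stationarity equation has at most one positive solution if the increments of `f` over two
steps decrease. -/
theorem eq_of_sq_eq {f : ℕ → ℝ} (hf : f ∈ classF) (hanti : Antitone f)
    (hconc : Antitone fun j => f (j + 2) - f j) {β : ℝ} (hβ : 0 < β) {θ₁ θ₂ : ℝ≥0} (h₁ : 0 < θ₁)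
    (h₂ : 0 < θ₂)
    (e₁ : (θ₁ : ℝ) ^ 2 = β * (sigma f hf θ₁).mean) (e₂ : (θ₂ : ℝ) ^ 2 = β * (sigma f hf θ₂).mean) :
    θ₁ = θ₂ := by
  wlog hlt : θ₁ < θ₂ generalizing θ₁ θ₂
  · rcases lt_trichotomy θ₁ θ₂ with h | h | h
    · exact absurd h hlt
    · exact h
    · exact (this h₂ h₁ e₂ e₁ h).symm
  exfalso
  have s₁ := hasSum_of_sq_eq hf e₁
  have s₂ := hasSum_of_sq_eq hf e₂
  set c : ℕ → ℝ := fun j => Real.exp (f j) / j.factorial -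
      β * (Real.exp (f (j + 2)) / (j + 1).factorial) with hc
  -- The last factor increases with `j`, so the coefficients change sign at most once, from
  -- nonpositive to positive.
  have hcj : ∀ j, c j = Real.exp (f j) / (j + 1).factorial *
      ((j : ℝ) + 1 - β * Real.exp (f (j + 2) - f j)) := by
    intro j
    simp only [hc]
    rw [Nat.factorial_succ, Real.exp_sub]
    push_cast
    field_simp
  have hpos : ∀ j, 0 < c j ↔ 0 < (j : ℝ) + 1 - β * Real.exp (f (j + 2) - f j) := by
    intro j
    rw [hcj]
    exact mul_pos_iff_of_pos_left (by positivity)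
  have hex : ∃ N, 0 < c N := by
    obtain ⟨N, hN⟩ := exists_nat_gt β
    refine ⟨N, (hpos N).2 ?_⟩
    have h1 : Real.exp (f (N + 2) - f N) ≤ 1 :=
      Real.exp_le_one_iff.2 (sub_nonpos.2 (hanti (by omega)))
    nlinarith
  classical
  obtain ⟨N, hN, hmin⟩ : ∃ N, 0 < c N ∧ ∀ j < N, ¬ 0 < c j :=
    ⟨Nat.find hex, Nat.find_spec hex, fun j hj => Nat.find_min hex hj⟩
  have hge : ∀ j, N ≤ j → 0 < c j := by
    intro j hj
    rw [hpos] at hN ⊢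
    have h1 : Real.exp (f (j + 2) - f j) ≤ Real.exp (f (N + 2) - f N) :=
      Real.exp_le_exp.2 (hconc hj)
    have h2 : (N : ℝ) ≤ j := by exact_mod_cast hj
    nlinarith
  have p₁ : (0 : ℝ) < θ₁ := h₁
  set t : ℝ := θ₂ / θ₁ with ht
  have ht1 : 1 < t := by rw [ht, one_lt_div p₁]; exact hlt
  have ht2 : (θ₂ : ℝ) = t * θ₁ := by rw [ht]; field_simp
  -- Replacing `t ^ (j + 2)` by its value at the sign change `N` lowers every term. The sum thus
  -- grows at least by `t ^ (N + 2)`, while the linear right side grows only by `t`.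
  have hle : t ^ (N + 2) * (β * θ₁ * Real.exp (f 1)) ≤ β * θ₂ * Real.exp (f 1) := by
    refine hasSum_le (fun j => ?_) (s₁.mul_left (t ^ (N + 2))) s₂
    rw [ht2, mul_pow, ← sub_nonneg]
    have h1 : 0 ≤ (t ^ (j + 2) - t ^ (N + 2)) * c j := by
      rcases lt_or_ge j N with h | h
      · exact mul_nonneg_of_nonpos_of_nonpos
          (sub_nonpos.2 (pow_le_pow_right₀ ht1.le (by omega))) (not_lt.1 (hmin j h))
      · exact mul_nonneg (sub_nonneg.2 (pow_le_pow_right₀ ht1.le (by omega))) (hge j h).le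
    have h2 : (0 : ℝ) ≤ (θ₁ : ℝ) ^ (j + 2) := by positivity
    nlinarith [mul_nonneg h2 h1]
  have h3 : t < t ^ (N + 2) := by
    calc t = t ^ 1 := (pow_one t).symm
      _ < t ^ (N + 2) := pow_lt_pow_right₀ ht1 (by omega)
  rw [ht2] at hle
  have h4 : 0 < β * θ₁ * Real.exp (f 1) := by positivity
  nlinarith

/-! ### Extended-real series and the functional on laws of infinite energy. -/

theorem tsum_ofReal_eq {a : ℕ → ℝ} (h : Summable fun i => max (a i) 0) :
    (∑' i, ENNReal.ofReal (a i)) = ENNReal.ofReal (∑' i, max (a i) 0) := by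
  rw [ENNReal.ofReal_tsum_of_nonneg (fun i => le_max_right _ _) h]
  refine tsum_congr fun i => ?_
  rcases le_total (a i) 0 with h | h
  · rw [max_eq_right h, ENNReal.ofReal_zero, ENNReal.ofReal_of_nonpos h]
  · rw [max_eq_left h]

theorem tsum_ofReal_eq_top {a : ℕ → ℝ} (h : ¬ Summable fun i => max (a i) 0) :
    (∑' i, ENNReal.ofReal (a i)) = ⊤ := by
  by_contra hne
  refine h ?_
  have h1 := ENNReal.summable_toReal hne
  refine h1.congr fun i => ?_
  rw [ENNReal.toReal_ofReal']

theorem extSum_of_summable {a : ℕ → ℝ} (h : Summable a) :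
    extSum a = ((∑' i, a i : ℝ) : EReal) := by
  have hp : Summable fun i => max (a i) 0 := by
    refine Summable.of_norm_bounded h.abs fun i => ?_
    rw [Real.norm_of_nonneg (le_max_right _ _)]
    exact max_le (le_abs_self _) (abs_nonneg _)
  have hn : Summable fun i => max (-a i) 0 := by
    refine Summable.of_norm_bounded h.abs fun i => ?_
    rw [Real.norm_of_nonneg (le_max_right _ _)]
    exact max_le (neg_le_abs _) (abs_nonneg _)
  rw [extSum, tsum_ofReal_eq hp, tsum_ofReal_eq hn, EReal.coe_ennreal_ofReal,
    EReal.coe_ennreal_ofReal, max_eq_left (tsum_nonneg fun i => le_max_right _ _),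
    max_eq_left (tsum_nonneg fun i => le_max_right _ _), ← EReal.coe_sub, ← hp.tsum_sub hn]
  congr 2
  ext i
  rcases le_total (a i) 0 with h | h
  · rw [max_eq_right h, max_eq_left (by linarith)]; ring
  · rw [max_eq_left h, max_eq_right (by linarith)]; ring

theorem extSum_of_not_summable {a : ℕ → ℝ} (h : ¬ Summable a)
    (hn : Summable fun i => max (-a i) 0) : extSum a = ⊤ := by
  have hp : ¬ Summable fun i => max (a i) 0 := by
    intro hp
    refine h ((hp.sub hn).congr fun i => ?_)
    rcases le_total (a i) 0 with h | h
    · rw [max_eq_right h, max_eq_left (by linarith)]; ring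
    · rw [max_eq_left h, max_eq_right (by linarith)]; ring
  rw [extSum, tsum_ofReal_eq_top hp, tsum_ofReal_eq hn, EReal.coe_ennreal_ofReal,
    EReal.coe_ennreal_top, EReal.top_sub_coe]

/-- Comparison with the weights `1 / i!`: each entropy term is at least `μ i - 1 / i!`, so the
negative parts are dominated by a convergent series. -/
theorem summable_entropy_neg (μ : FiniteMeanLaw) :
    Summable fun i => max (-(μ.mass i * Real.log ((Nat.factorial i : ℝ) * μ.mass i))) 0 := by
  refine Summable.of_norm_bounded (hasSum_exp_nnreal 1).summable fun i => ?_
  rw [Real.norm_of_nonneg (le_max_right _ _)]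
  refine max_le ?_ (by positivity)
  have h := sub_le_mul_log_div (μ.nonneg i) (b := 1 / (i.factorial : ℝ)) (by positivity)
  rw [div_div_eq_mul_div, div_one, mul_comm (μ.mass i) (i.factorial : ℝ)] at h
  have h2 := μ.nonneg i
  simp only [NNReal.coe_one, one_pow, mul_one]
  linarith

theorem rate_eq_of_summable (β : ℝ) {μ : FiniteMeanLaw}
    (h : Summable fun i => μ.mass i * Real.log ((Nat.factorial i : ℝ) * μ.mass i)) :
    rate β μ = ((∑' i, μ.mass i * Real.log ((Nat.factorial i : ℝ) * μ.mass i) +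
      (-(μ.mean / 2) * Real.log (μ.mean * β) + (μ.mean + β) / 2) : ℝ) : EReal) := by
  rw [rate, extSum_of_summable h, ← EReal.coe_add]

theorem rate_eq_top (β : ℝ) {μ : FiniteMeanLaw}
    (h : ¬ Summable fun i => μ.mass i * Real.log ((Nat.factorial i : ℝ) * μ.mass i)) :
    rate β μ = ⊤ := by
  rw [rate, extSum_of_not_summable h (summable_entropy_neg μ), EReal.top_add_coe]

theorem rate_sub_expect {β : ℝ} {f : ℕ → ℝ} {μ : FiniteMeanLaw} (h : FiniteEnergy f μ) :
    rate β μ - μ.expect f = (freeEnergy β f μ : EReal) := by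
  rw [rate_eq_of_summable β h.entropy, FiniteMeanLaw.expect, extSum_of_summable h.energy,
    ← EReal.coe_sub, freeEnergy]
  congr 1
  ring

theorem starFunctional_of_finiteEnergy {β : ℝ} {k : ℕ} {γ : ℝ} (hγ : γ < 0) {μ : FiniteMeanLaw}
    (h : FiniteEnergy (starFun k γ) μ) :
    starFunctional β k γ μ = ((-freeEnergy β (starFun k γ) μ : ℝ) : EReal) := by
  have h1 : Summable fun i => μ.mass i * (Nat.choose i k : ℝ) :=
    (h.energy.mul_left γ⁻¹).congr fun i => by
      rw [starFun]; have := hγ.ne; field_simp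
  have h2 : ∑' i, μ.mass i * starFun k γ i = γ * ∑' i, μ.mass i * (Nat.choose i k : ℝ) := by
    rw [← tsum_mul_left]
    exact tsum_congr fun i => by rw [starFun]; ring
  rw [starFunctional, FiniteMeanLaw.expect, extSum_of_summable h1,
    rate_eq_of_summable β h.entropy, ← EReal.coe_mul, ← EReal.coe_sub, freeEnergy, h2]
  congr 1
  ring

theorem starFunctional_of_not_finiteEnergy {β : ℝ} {k : ℕ} {γ : ℝ} (hγ : γ < 0)
    {μ : FiniteMeanLaw} (h : ¬ FiniteEnergy (starFun k γ) μ) : starFunctional β k γ μ = ⊥ := by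
  rw [starFunctional]
  by_cases h1 : Summable fun i => μ.mass i * (Nat.choose i k : ℝ)
  · have h2 : ¬ Summable fun i => μ.mass i * Real.log ((Nat.factorial i : ℝ) * μ.mass i) :=
      fun h2 => h ⟨h2, (h1.mul_left γ).congr fun i => by rw [starFun]; ring⟩
    rw [rate_eq_top β h2, EReal.sub_top]
  · have h2 : μ.expect (fun i => (Nat.choose i k : ℝ)) = ⊤ := by
      refine extSum_of_not_summable h1 ?_
      refine summable_zero.congr fun i => ?_
      have := mul_nonneg (μ.nonneg i) (Nat.cast_nonneg (α := ℝ) (i.choose k))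
      rw [max_eq_right (by linarith)]
    rw [h2, EReal.coe_mul_top_of_neg hγ, EReal.bot_sub]

/-! ### The star function and its variational problem. -/

section StarFun

variable {k : ℕ} {γ : ℝ}

theorem starFun_antitone (hγ : γ < 0) : Antitone (starFun k γ) := fun _ _ hij =>
  mul_le_mul_of_nonpos_left (Nat.cast_le.2 (Nat.choose_le_choose k hij)) hγ.le

theorem starFun_nonpos (hγ : γ < 0) (i : ℕ) : starFun k γ i ≤ 0 :=
  mul_nonpos_of_nonpos_of_nonneg hγ.le (Nat.cast_nonneg _)

theorem starFun_neg (hγ : γ < 0) : starFun k γ k < 0 := by simpa [starFun] using hγ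

/-- Pascal's rule applied twice writes the two-step increment as `γ` times a sum of two binomial
coefficients of order `k - 1`, monotone in `j`. -/
theorem starFun_increments_antitone (hk : 1 ≤ k) (hγ : γ < 0) :
    Antitone fun j => starFun k γ (j + 2) - starFun k γ j := by
  obtain ⟨l, rfl⟩ := Nat.exists_eq_add_of_le' hk
  have h : ∀ j, starFun (l + 1) γ (j + 2) - starFun (l + 1) γ j =
      γ * ((Nat.choose (j + 1) l + Nat.choose j l : ℕ) : ℝ) := by
    intro j
    rw [starFun, starFun, Nat.choose_succ_succ' (j + 1), Nat.choose_succ_succ' j l]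
    push_cast
    ring
  intro i j hij
  simp only [h]
  exact mul_le_mul_of_nonpos_left (Nat.cast_le.2 (add_le_add
    (Nat.choose_le_choose l (by omega)) (Nat.choose_le_choose l hij))) hγ.le

end StarFun

/-- The unique minimizer of the dual rate function. -/
theorem exists_unique_min_dualRate {β : ℝ} {k : ℕ} {γ : ℝ} (hk : 1 ≤ k) (hγ : γ < 0)
    (hβ : 0 < β) : ∃ θ₀ : ℝ≥0, 0 < θ₀ ∧ dualRate β (starFun k γ) θ₀ < β / 2 ∧
      (∀ θ, dualRate β (starFun k γ) θ₀ ≤ dualRate β (starFun k γ) θ) ∧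
      ∀ θ, dualRate β (starFun k γ) θ = dualRate β (starFun k γ) θ₀ → θ = θ₀ := by
  have hf := starFun_mem_classF hk hγ
  have hneg := starFun_nonpos (k := k) hγ
  obtain ⟨θ₀, h0, hlt, hmin⟩ := exists_isMin_dualRate hf hneg hβ
  refine ⟨θ₀, h0, hlt, hmin, fun θ hθ => ?_⟩
  have hθ0 : 0 < θ := by
    rw [pos_iff_ne_zero]
    rintro rfl
    rw [dualRate_zero hf] at hθ
    linarith
  exact eq_of_sq_eq hf (starFun_antitone hγ) (starFun_increments_antitone hk hγ) hβ hθ0 h0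
    (sq_eq_of_isMin hf hneg hβ hθ0 (hθ ▸ hmin)) (sq_eq_of_isMin hf hneg hβ h0 hmin)

section Variational

variable {β : ℝ} {k : ℕ} {γ : ℝ} {θ₀ : ℝ≥0}

theorem starFunctional_sigma (hk : 1 ≤ k) (hγ : γ < 0) (hβ : 0 < β)
    (hmin : ∀ θ, dualRate β (starFun k γ) θ₀ ≤ dualRate β (starFun k γ) θ) :
    starFunctional β k γ (sigma (starFun k γ) (starFun_mem_classF hk hγ) θ₀) =
      ((-dualRate β (starFun k γ) θ₀ : ℝ) : EReal) := by
  have hf := starFun_mem_classF hk hγ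
  have hneg := starFun_nonpos (k := k) hγ
  rw [starFunctional_of_finiteEnergy hγ (finiteEnergy_sigma hf hneg θ₀)]
  congr 2
  exact le_antisymm (freeEnergy_sigma_le hf hneg hβ θ₀)
    ((hmin _).trans (dualRate_meanParam_le hf hβ (finiteEnergy_sigma hf hneg θ₀)).1)

theorem starFunctional_le (hk : 1 ≤ k) (hγ : γ < 0) (hβ : 0 < β)
    (hmin : ∀ θ, dualRate β (starFun k γ) θ₀ ≤ dualRate β (starFun k γ) θ) (μ : FiniteMeanLaw) :
    starFunctional β k γ μ ≤ ((-dualRate β (starFun k γ) θ₀ : ℝ) : EReal) := by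
  by_cases h : FiniteEnergy (starFun k γ) μ
  · rw [starFunctional_of_finiteEnergy hγ h, EReal.coe_le_coe_iff, neg_le_neg_iff]
    exact (hmin _).trans (dualRate_meanParam_le (starFun_mem_classF hk hγ) hβ h).1
  · rw [starFunctional_of_not_finiteEnergy hγ h]
    exact bot_le

theorem iSup_starFunctional (hk : 1 ≤ k) (hγ : γ < 0) (hβ : 0 < β)
    (hmin : ∀ θ, dualRate β (starFun k γ) θ₀ ≤ dualRate β (starFun k γ) θ) :
    ⨆ μ, starFunctional β k γ μ = ((-dualRate β (starFun k γ) θ₀ : ℝ) : EReal) :=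
  le_antisymm (iSup_le (starFunctional_le hk hγ hβ hmin))
    ((starFunctional_sigma hk hγ hβ hmin).ge.trans (le_iSup _ _))

theorem J_starFun (hk : 1 ≤ k) (hγ : γ < 0) (hβ : 0 < β)
    (hmin : ∀ θ, dualRate β (starFun k γ) θ₀ ≤ dualRate β (starFun k γ) θ) :
    J β (starFun k γ) (starFun_mem_classF hk hγ) =
      ((dualRate β (starFun k γ) θ₀ : ℝ) : EReal) := by
  have hf := starFun_mem_classF hk hγ
  have hneg := starFun_nonpos (k := k) hγ
  refine le_antisymm (iInf_le_of_le θ₀ ?_) (le_iInf fun θ => ?_)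
  · rw [rate_sub_expect (finiteEnergy_sigma hf hneg θ₀), EReal.coe_le_coe_iff]
    exact freeEnergy_sigma_le hf hneg hβ θ₀
  · rw [rate_sub_expect (finiteEnergy_sigma hf hneg θ), EReal.coe_le_coe_iff]
    exact (hmin _).trans (dualRate_meanParam_le hf hβ (finiteEnergy_sigma hf hneg θ)).1

/-- At a maximizer both inequalities in `min dualRate ≤ dualRate (meanParam β μ) ≤ freeEnergy μ` are
equalities: one fixes the parameter, the other the law. -/
theorem starMaximizers_eq (hk : 1 ≤ k) (hγ : γ < 0) (hβ : 0 < β)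
    (hmin : ∀ θ, dualRate β (starFun k γ) θ₀ ≤ dualRate β (starFun k γ) θ)
    (huniq : ∀ θ, dualRate β (starFun k γ) θ = dualRate β (starFun k γ) θ₀ → θ = θ₀) :
    starMaximizers β k γ = {sigma (starFun k γ) (starFun_mem_classF hk hγ) θ₀} := by
  have hf := starFun_mem_classF hk hγ
  ext μ
  rw [starMaximizers, Set.mem_ofPred_eq, iSup_starFunctional hk hγ hβ hmin, Set.mem_singleton_iff]
  refine ⟨fun h => ?_, fun h => h ▸ starFunctional_sigma hk hγ hβ hmin⟩
  by_cases hμ : FiniteEnergy (starFun k γ) μ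
  · rw [starFunctional_of_finiteEnergy hγ hμ, EReal.coe_eq_coe_iff, neg_inj] at h
    obtain ⟨h1, h2⟩ := dualRate_meanParam_le hf hβ hμ
    have h3 := le_antisymm (h1.trans h.le) (hmin (meanParam β μ))
    rw [h2 (h.trans h3.symm), huniq _ h3]
  · rw [starFunctional_of_not_finiteEnergy hγ hμ] at h
    exact absurd h (EReal.bot_ne_coe _)

end Variational

/-! ### Chernoff bounds for independent degrees. -/

/-- The mass `θ ^ j e ^ (f j) / j!` before normalisation. -/
noncomputable def pgfTerm (f : ℕ → ℝ) (θ : ℝ≥0) (j : ℕ) : ℝ :=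
  1 / (Nat.factorial j : ℝ) * (θ : ℝ) ^ j * Real.exp (f j)

theorem pgfTerm_nonneg (f : ℕ → ℝ) (θ : ℝ≥0) (j : ℕ) : 0 ≤ pgfTerm f θ j := by
  unfold pgfTerm; positivity

theorem hasSum_pgfTerm {f : ℕ → ℝ} (hf : f ∈ classF) (θ : ℝ≥0) :
    HasSum (pgfTerm f θ) (pgf f θ) := (summable_weight hf θ).hasSum

theorem pgfTerm_eq {f : ℕ → ℝ} (hf : f ∈ classF) (θ : ℝ≥0) (j : ℕ) :
    pgfTerm f θ j = pgf f θ * (sigma f hf θ).mass j := by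
  rw [← exp_logNorm hf]
  simp only [sigma, pgfTerm]
  rw [← mul_assoc, ← Real.exp_add, add_neg_cancel, Real.exp_zero, one_mul]

theorem sum_prod_le_pow {n : ℕ} {a : ℕ → ℝ} (ha : ∀ j, 0 ≤ a j) {A : ℝ} (hA : HasSum a A) :
    ∑ d ∈ Fintype.piFinset (fun _ : Fin n => Finset.range n), ∏ v, a (d v) ≤ A ^ n := by
  rw [← Finset.prod_univ_sum (fun _ : Fin n => Finset.range n) fun _ j => a j,
    Finset.prod_const, Finset.card_univ, Fintype.card_fin]
  exact pow_le_pow_left₀ (Finset.sum_nonneg fun j _ => ha j) (sum_le_hasSum _ (fun j _ => ha j) hA) n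

/-- The number of vertices at which the sequence `d` takes the value `i`. -/
def countEq {n : ℕ} (d : Fin n → ℕ) (i : ℕ) : ℕ := (Finset.univ.filter fun v => d v = i).card

theorem sigma_mass_le_one {f : ℕ → ℝ} (hf : f ∈ classF) (θ : ℝ≥0) (i : ℕ) :
    (sigma f hf θ).mass i ≤ 1 :=
  le_hasSum (sigma f hf θ).hasSum_one i fun j _ => (sigma f hf θ).nonneg j

open Classical in
-- Exponential tilting of the mass at `i`, with `e^s ≤ 1 + s + s²`. A tilt `s` of either sign covers
-- both tails.
theorem chernoff {n : ℕ} {f : ℕ → ℝ} (hf : f ∈ classF) (θ : ℝ≥0) (i : ℕ) {s y : ℝ}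
    (hs : |s| ≤ 1) :
    ∑ d ∈ Fintype.piFinset (fun _ : Fin n => Finset.range n) with
        s * (n * y) ≤ s * countEq d i, ∏ v, pgfTerm f θ (d v) ≤
      pgf f θ ^ n * Real.exp (n * (s * ((sigma f hf θ).mass i - y) + s ^ 2)) := by
  set a : ℕ → ℝ := fun j => pgfTerm f θ j * Real.exp (if j = i then s else 0) with ha
  have ha0 : ∀ j, 0 ≤ a j := fun j => mul_nonneg (pgfTerm_nonneg f θ j) (Real.exp_pos _).le
  have hA : HasSum a (pgf f θ + pgfTerm f θ i * (Real.exp s - 1)) := by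
    have h := (hasSum_pgfTerm hf θ).add (hasSum_ite_eq i (pgfTerm f θ i * (Real.exp s - 1)))
    refine h.congr_fun fun j => ?_
    simp only [ha]
    split_ifs with hj
    · rw [hj]; ring
    · simp
  have h1 : pgf f θ + pgfTerm f θ i * (Real.exp s - 1) ≤
      pgf f θ * Real.exp (s * (sigma f hf θ).mass i + s ^ 2) := by
    rw [pgfTerm_eq hf]
    have hq0 := (sigma f hf θ).nonneg i
    have hq1 := sigma_mass_le_one hf θ i
    generalize (sigma f hf θ).mass i = q at hq0 hq1
    have h2 := Real.add_one_le_exp (s * q + s ^ 2)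
    have h3 := (abs_le.1 (Real.abs_exp_sub_one_sub_id_le hs)).2
    have h4 : q * (Real.exp s - 1) ≤ s * q + s ^ 2 := by nlinarith [sq_nonneg s]
    have h5 := mul_le_mul_of_nonneg_left (h2.trans' (add_le_add_left h4 1)) (pgf_pos hf θ).le
    linarith
  have hcount : ∀ d : Fin n → ℕ, ∑ v, (if d v = i then s else 0) = s * countEq d i := by
    intro d
    rw [Finset.sum_ite, Finset.sum_const, Finset.sum_const_zero, add_zero, nsmul_eq_mul, mul_comm,
      countEq]
  calc _ ≤ ∑ d ∈ Fintype.piFinset (fun _ : Fin n => Finset.range n),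
        Real.exp (-(s * (n * y))) * ∏ v, a (d v) := by
        refine (Finset.sum_le_sum fun d hd => ?_).trans
          (Finset.sum_le_sum_of_subset_of_nonneg (Finset.filter_subset _ _) fun d _ _ =>
            mul_nonneg (Real.exp_pos _).le (Finset.prod_nonneg fun _ _ => ha0 _))
        simp only [ha]
        rw [Finset.prod_mul_distrib, ← Real.exp_sum, hcount, mul_left_comm, ← Real.exp_add]
        refine le_mul_of_one_le_right (Finset.prod_nonneg fun _ _ => pgfTerm_nonneg _ _ _) ?_
        rw [Real.one_le_exp_iff]
        have := (Finset.mem_filter.1 hd).2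
        linarith
    _ ≤ Real.exp (-(s * (n * y))) * (pgf f θ + pgfTerm f θ i * (Real.exp s - 1)) ^ n := by
        rw [← Finset.mul_sum]
        exact mul_le_mul_of_nonneg_left (sum_prod_le_pow ha0 hA) (Real.exp_pos _).le
    _ ≤ Real.exp (-(s * (n * y))) *
          (pgf f θ * Real.exp (s * (sigma f hf θ).mass i + s ^ 2)) ^ n := by
        refine mul_le_mul_of_nonneg_left (pow_le_pow_left₀ (hA.nonneg ha0) h1 n) (Real.exp_pos _).le
    _ = _ := by
        rw [mul_pow, ← Real.exp_nat_mul, mul_left_comm, ← Real.exp_add]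
        congr 2
        ring

open Classical in
/-- Deviations of the empirical frequency of `i` are exponentially unlikely. -/
theorem sum_deviation_le {n : ℕ} {f : ℕ → ℝ} (hf : f ∈ classF) (θ : ℝ≥0) (i : ℕ) {q ρ : ℝ}
    (hn : 0 < n) (hρ : 0 < ρ) (hρ1 : ρ ≤ 1) (hq : |(sigma f hf θ).mass i - q| ≤ ρ / 2) :
    ∑ d ∈ Fintype.piFinset (fun _ : Fin n => Finset.range n) with
        ρ ≤ |(countEq d i : ℝ) / n - q|, ∏ v, pgfTerm f θ (d v) ≤
      2 * (pgf f θ ^ n * Real.exp (-(ρ ^ 2 / 16 * n))) := by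
  have hn0 : (0 : ℝ) < n := by exact_mod_cast hn
  obtain ⟨hq1, hq2⟩ := abs_le.1 hq
  -- The true mass is at least `ρ / 2` below `q + ρ`, and `s = ρ / 4` minimizes `-s ρ / 2 + s²`,
  -- with value `-ρ² / 16`.
  have e1 := chernoff (n := n) hf θ i (s := ρ / 4) (y := q + ρ)
    (by rw [abs_of_pos (by positivity)]; linarith)
  have e2 := chernoff (n := n) hf θ i (s := -(ρ / 4)) (y := q - ρ)
    (by rw [abs_neg, abs_of_pos (by positivity)]; linarith)
  have b1 : Real.exp (n * (ρ / 4 * ((sigma f hf θ).mass i - (q + ρ)) + (ρ / 4) ^ 2)) ≤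
      Real.exp (-(ρ ^ 2 / 16 * n)) := by
    rw [Real.exp_le_exp]; nlinarith [mul_le_mul_of_nonneg_left hq2 (mul_pos hn0 hρ).le]
  have b2 : Real.exp (n * (-(ρ / 4) * ((sigma f hf θ).mass i - (q - ρ)) + (-(ρ / 4)) ^ 2)) ≤
      Real.exp (-(ρ ^ 2 / 16 * n)) := by
    rw [Real.exp_le_exp]; nlinarith [mul_le_mul_of_nonneg_left hq1 (mul_pos hn0 hρ).le]
  have hpow : 0 ≤ pgf f θ ^ n := pow_nonneg (pgf_pos hf θ).le n
  have hsub : (Fintype.piFinset (fun _ : Fin n => Finset.range n)).filter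
      (fun d => ρ ≤ |(countEq d i : ℝ) / n - q|) ⊆
      (Fintype.piFinset (fun _ : Fin n => Finset.range n)).filter
        (fun d => ρ / 4 * (n * (q + ρ)) ≤ ρ / 4 * countEq d i) ∪
      (Fintype.piFinset (fun _ : Fin n => Finset.range n)).filter
        (fun d => -(ρ / 4) * (n * (q - ρ)) ≤ -(ρ / 4) * countEq d i) := by
    intro d hd
    rw [Finset.mem_filter] at hd
    rw [Finset.mem_union, Finset.mem_filter, Finset.mem_filter]
    rcases le_abs.1 hd.2 with h | h
    · refine Or.inl ⟨hd.1, ?_⟩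
      refine mul_le_mul_of_nonneg_left ?_ (by positivity)
      have : q + ρ ≤ (countEq d i : ℝ) / n := by linarith
      rw [le_div_iff₀ hn0] at this
      linarith
    · refine Or.inr ⟨hd.1, ?_⟩
      refine mul_le_mul_of_nonpos_left ?_ (by linarith)
      have : (countEq d i : ℝ) / n ≤ q - ρ := by linarith
      rw [div_le_iff₀ hn0] at this
      linarith
  have hnn : ∀ d : Fin n → ℕ, 0 ≤ ∏ v, pgfTerm f θ (d v) :=
    fun d => Finset.prod_nonneg fun _ _ => pgfTerm_nonneg _ _ _
  refine (Finset.sum_le_sum_of_subset_of_nonneg hsub fun d _ _ => hnn d).trans ?_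
  have h := Finset.sum_union_inter (s₁ := (Fintype.piFinset (fun _ : Fin n => Finset.range n)).filter
        (fun d => ρ / 4 * (n * (q + ρ)) ≤ ρ / 4 * countEq d i)) (s₂ :=
      (Fintype.piFinset (fun _ : Fin n => Finset.range n)).filter
        (fun d => -(ρ / 4) * (n * (q - ρ)) ≤ -(ρ / 4) * countEq d i))
        (f := fun d => ∏ v, pgfTerm f θ (d v))
  have h0 := Finset.sum_nonneg (s := (Fintype.piFinset (fun _ : Fin n => Finset.range n)).filter
        (fun d => ρ / 4 * (n * (q + ρ)) ≤ ρ / 4 * countEq d i) ∩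
      (Fintype.piFinset (fun _ : Fin n => Finset.range n)).filter
        (fun d => -(ρ / 4) * (n * (q - ρ)) ≤ -(ρ / 4) * countEq d i)) fun d _ => hnn d
  have e1' := e1.trans (mul_le_mul_of_nonneg_left b1 hpow)
  have e2' := e2.trans (mul_le_mul_of_nonneg_left b2 hpow)
  linarith

/-! ### Exponential upper bounds by edge number. -/

/-- Here `E = n θ² / (2β) - θ² / 2`. For `θ ≤ 4β` the correction `θ² / 2` is at most `8β²`; for
larger `θ`, `E ≥ n θ ≥ n * logNorm f θ` makes the exponent nonpositive. -/
theorem exponent_le {f : ℕ → ℝ} (hf : f ∈ classF) (hneg : ∀ i, f i ≤ 0) {β : ℝ} (hβ : 0 < β)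
    {n : ℕ} (hn : 2 * β ≤ n) {m : ℝ} (hm : m ≤ β / 2) {θ : ℝ≥0} (hθ : m ≤ dualRate β f θ) {E : ℕ}
    (hE : (θ : ℝ) ^ 2 = 2 * (β / (n - β)) * E) :
    -(E : ℝ) + n * logNorm f θ ≤ n * (β / 2 - m) + 8 * β ^ 2 := by
  have hnβ : 0 < (n : ℝ) - β := by linarith
  have hE' : (E : ℝ) = n * ((θ : ℝ) ^ 2 / (2 * β)) - (θ : ℝ) ^ 2 / 2 := by
    rw [hE]; field_simp
  have hn0 : (0 : ℝ) ≤ n := Nat.cast_nonneg n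
  rcases le_total (θ : ℝ) (4 * β) with h | h
  · have h1 : n * logNorm f θ = n * ((θ : ℝ) ^ 2 / (2 * β) + β / 2 - dualRate β f θ) := by
      rw [dualRate]; ring
    have h2 : (θ : ℝ) ^ 2 ≤ (4 * β) ^ 2 := pow_le_pow_left₀ θ.coe_nonneg h 2
    have h3 := mul_le_mul_of_nonneg_left hθ hn0
    rw [h1, hE']
    nlinarith
  · have h1 := mul_le_mul_of_nonneg_left (logNorm_le hf hneg θ) hn0
    have h2 : (n : ℝ) * θ ≤ E := by
      have h4 : (n : ℝ) / 2 ≤ n - β := by linarith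
      have h5 : (E : ℝ) = (n - β) * ((θ : ℝ) ^ 2 / (2 * β)) := by rw [hE']; field_simp
      have h6 : 2 * (θ : ℝ) ≤ (θ : ℝ) ^ 2 / (2 * β) := by
        rw [le_div_iff₀ (by positivity)]
        nlinarith [θ.coe_nonneg]
      rw [h5]
      calc (n : ℝ) * θ = n / 2 * (2 * θ) := by ring
        _ ≤ _ := mul_le_mul h4 h6 (by positivity) hnβ.le
    have h3 : 0 ≤ n * (β / 2 - m) := mul_nonneg hn0 (by linarith)
    have h4 : 0 ≤ 8 * β ^ 2 := by positivity
    linarith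

open Classical in
/-- The master upper bound: each edge number `E` selects a parameter `θ` at which either the dual
rate function is large or the degree sequences in `T` are unlikely. -/
theorem sum_graphWeight_le_exp {f : ℕ → ℝ} (hf : f ∈ classF) (hneg : ∀ i, f i ≤ 0) {β : ℝ}
    (hβ : 0 < β) {n : ℕ} (hn : 2 * β ≤ n) (T : Set (Fin n → ℕ)) {m c K : ℝ} (hK : 1 ≤ K)
    (hc : 0 ≤ c) (hmc : m + c ≤ β / 2) (hm : ∀ θ, m ≤ dualRate β f θ)
    (h : ∀ (E : ℕ) (θ : ℝ≥0), (θ : ℝ) ^ 2 = 2 * (β / (n - β)) * E → m + c ≤ dualRate β f θ ∨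
      ∑ d ∈ Fintype.piFinset (fun _ : Fin n => Finset.range n) with
        ∑ v, d v = 2 * E ∧ d ∈ T, ∏ v, pgfTerm f θ (d v) ≤
          K * Real.exp (-(c * n)) * pgf f θ ^ n) :
    ∑ G : SimpleGraph (Fin n) with (fun v => G.degree v) ∈ T,
        graphWeight (β / (n - β)) (fun i => Real.exp (f i)) G ≤
      ((n : ℝ) ^ 2 + 1) * (Real.exp 1 * ((n : ℝ) ^ 2 + 1) * (K *
        Real.exp (n * (β / 2 - m - c) + 8 * β ^ 2))) := by
  have hnβ : 0 < (n : ℝ) - β := by linarith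
  have hx : 0 < β / (n - β) := div_pos hβ hnβ
  refine (sum_graphWeight_le hx.le (fun i => (Real.exp_pos (f i)).le) T).trans ?_
  have hcard : ((n : ℝ) ^ 2 + 1) = ((Finset.range (n ^ 2 + 1)).card : ℝ) := by
    rw [Finset.card_range]; push_cast; ring
  conv_rhs => rw [hcard]
  rw [← nsmul_eq_mul, ← hcard]
  refine Finset.sum_le_card_nsmul _ _ _ fun E hE => ?_
  have hEn : (E : ℝ) + 1 ≤ (n : ℝ) ^ 2 + 1 := by
    have : E + 1 ≤ n ^ 2 + 1 := Finset.mem_range.1 hE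
    exact_mod_cast this
  set x := β / ((n : ℝ) - β) with hxdef
  -- With this `θ` the factor `(2xE)^E` is `θ^(2E)`, which distributes over the vertices because the
  -- degrees sum to `2E`.
  have hexθ : ∃ θ : ℝ≥0, (θ : ℝ) ^ 2 = 2 * x * E :=
    ⟨(Real.sqrt (2 * x * E)).toNNReal, by
      rw [Real.coe_toNNReal _ (Real.sqrt_nonneg _), Real.sq_sqrt (by positivity)]⟩
  obtain ⟨θ, hθ⟩ := hexθ
  have hS : ∀ d : Fin n → ℕ, ∑ v, d v = 2 * E →
      (2 * x * E) ^ E * ∏ v, (Real.exp (f (d v)) / (d v).factorial) = ∏ v, pgfTerm f θ (d v) := by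
    intro d hd
    rw [← hθ, ← pow_mul, ← hd, ← Finset.prod_pow_eq_pow_sum, ← Finset.prod_mul_distrib]
    refine Finset.prod_congr rfl fun v _ => ?_
    rw [pgfTerm]; ring
  set A := ∑ d ∈ Fintype.piFinset (fun _ : Fin n => Finset.range n) with
        ∑ v, d v = 2 * E ∧ d ∈ T, ∏ v, pgfTerm f θ (d v) with hA
  have h1 : (2 * x) ^ E * E.factorial *
      ∑ d ∈ Fintype.piFinset (fun _ : Fin n => Finset.range n) with
        ∑ v, d v = 2 * E ∧ d ∈ T, ∏ v, (Real.exp (f (d v)) / (d v).factorial) ≤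
      Real.exp 1 * (E + 1) * (Real.exp (-E) * A) := by
    calc _ ≤ (2 * x) ^ E * (Real.exp 1 * (E + 1) * ((E : ℝ) ^ E * Real.exp (-E))) *
          ∑ d ∈ Fintype.piFinset (fun _ : Fin n => Finset.range n) with
            ∑ v, d v = 2 * E ∧ d ∈ T, ∏ v, (Real.exp (f (d v)) / (d v).factorial) := by
          refine mul_le_mul_of_nonneg_right (mul_le_mul_of_nonneg_left (factorial_le_mul_pow E)
            (by positivity)) (Finset.sum_nonneg fun d _ => by positivity)
      _ = Real.exp 1 * (E + 1) * (Real.exp (-E) * ((2 * x * E) ^ E *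
          ∑ d ∈ Fintype.piFinset (fun _ : Fin n => Finset.range n) with
            ∑ v, d v = 2 * E ∧ d ∈ T, ∏ v, (Real.exp (f (d v)) / (d v).factorial))) := by
          rw [mul_pow _ (E : ℝ)]; ring
      _ = _ := by
          rw [hA, Finset.mul_sum, Finset.sum_congr rfl fun d hd => hS d (Finset.mem_filter.1 hd).2.1]
  have hexp : Real.exp (-E) * pgf f θ ^ n = Real.exp (-E + n * logNorm f θ) := by
    rw [Real.exp_add, Real.exp_nat_mul, exp_logNorm hf]
  have hA0 : 0 ≤ A := Finset.sum_nonneg fun d _ =>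
    Finset.prod_nonneg fun _ _ => pgfTerm_nonneg _ _ _
  have h2 : Real.exp (-E) * A ≤ K * Real.exp (n * (β / 2 - m - c) + 8 * β ^ 2) := by
    rcases h E θ hθ with h3 | h3
    · have h4 : A ≤ pgf f θ ^ n := (Finset.sum_le_sum_of_subset_of_nonneg
        (Finset.filter_subset _ _) fun d _ _ =>
          Finset.prod_nonneg fun _ _ => pgfTerm_nonneg _ _ _).trans
        (sum_prod_le_pow (pgfTerm_nonneg f θ) (hasSum_pgfTerm hf θ))
      have h5 := exponent_le hf hneg hβ hn hmc h3 hθ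
      calc Real.exp (-E) * A ≤ Real.exp (-E) * pgf f θ ^ n := by gcongr
        _ ≤ Real.exp (n * (β / 2 - m - c) + 8 * β ^ 2) := by
            rw [hexp, Real.exp_le_exp]; linarith
        _ ≤ _ := le_mul_of_one_le_left (Real.exp_pos _).le hK
    · have h5 := exponent_le hf hneg hβ hn (by linarith) (hm θ) hθ
      calc Real.exp (-E) * A ≤ Real.exp (-E) * (K * Real.exp (-(c * n)) * pgf f θ ^ n) := by gcongr
        _ = K * (Real.exp (-(c * n)) * (Real.exp (-E) * pgf f θ ^ n)) := by ring
        _ ≤ _ := by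
            rw [hexp, ← Real.exp_add]
            refine mul_le_mul_of_nonneg_left (Real.exp_le_exp.2 ?_) (by linarith)
            linarith
  calc _ ≤ _ := h1
    _ ≤ _ := by gcongr

/-- A Scheffé argument: beyond `L`, `|μ i - ν i| ≤ (μ i - ν i) + 2 * ν i`. Closeness thus needs only
an upper bound on the mean of `μ`, finitely many masses and the tail of `ν`. -/
theorem dist_le_mean_sub {μ ν : FiniteMeanLaw} (L : ℕ) :
    dist μ ν ≤ (μ.mean - ν.mean) + 2 * ∑ i ∈ Finset.range L, (i : ℝ) * |μ.mass i - ν.mass i| +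
      2 * (ν.mean - ∑ i ∈ Finset.range L, (i : ℝ) * ν.mass i) := by
  have hfin : ∀ g : ℕ → ℝ, HasSum (fun i => if i < L then g i else 0) (∑ i ∈ Finset.range L, g i) := by
    intro g
    have h := hasSum_sum_of_ne_finset_zero (f := fun i => if i < L then g i else 0)
      (s := Finset.range L) (L := SummationFilter.unconditional ℕ)
      fun i hi => if_neg (by simpa using hi)
    rwa [Finset.sum_congr rfl fun i hi => if_pos (Finset.mem_range.1 hi)] at h
  have h := (((mean_hasSum μ).sub (mean_hasSum ν)).add
    ((hfin fun i => (i : ℝ) * |μ.mass i - ν.mass i|).mul_left 2)).add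
    (((mean_hasSum ν).sub (hfin fun i => (i : ℝ) * ν.mass i)).mul_left 2)
  refine hasSum_le (fun i => ?_) (FiniteMeanLaw.summable_dist μ ν).hasSum h
  have h1 := μ.nonneg i
  have h2 := ν.nonneg i
  have hi : (0 : ℝ) ≤ i := Nat.cast_nonneg i
  split_ifs
  · have h3 := mul_le_mul_of_nonneg_left (neg_abs_le (μ.mass i - ν.mass i)) hi
    linarith
  · have h3 : |μ.mass i - ν.mass i| ≤ μ.mass i + ν.mass i := by
      rw [abs_le]; constructor <;> linarith
    have h4 := mul_le_mul_of_nonneg_left h3 hi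
    linarith

theorem eventually_mul_pow_le_exp (K : ℝ) (c : ℕ) {ε : ℝ} (hε : 0 < ε) :
    ∀ᶠ n : ℕ in atTop, K * (n : ℝ) ^ c ≤ Real.exp (ε * n) := by
  have h := ((isLittleO_pow_exp_pos_mul_atTop c hε).comp_tendsto
    tendsto_natCast_atTop_atTop).def (c := 1 / (|K| + 1)) (by positivity)
  filter_upwards [h] with n hn
  simp only [Function.comp] at hn
  rw [Real.norm_of_nonneg (by positivity), Real.norm_of_nonneg (Real.exp_pos _).le,
    one_div_mul_eq_div, le_div_iff₀ (by positivity)] at hn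
  have h1 : K ≤ |K| + 1 := (le_abs_self K).trans (by linarith)
  have h2 : (0 : ℝ) ≤ (n : ℝ) ^ c := by positivity
  nlinarith

theorem eventually_prefactor_le_exp (K : ℝ) {ε : ℝ} (hε : 0 < ε) (hK : 0 ≤ K) :
    ∀ᶠ n : ℕ in atTop, ((n : ℝ) ^ 2 + 1) * (Real.exp 1 * ((n : ℝ) ^ 2 + 1) * K) ≤
      Real.exp (ε * n) := by
  filter_upwards [eventually_mul_pow_le_exp (4 * Real.exp 1 * K) 4 hε, eventually_ge_atTop 1]
    with n hn hn1
  refine le_trans ?_ hn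
  have h1 : (1 : ℝ) ≤ (n : ℝ) ^ 2 := one_le_pow₀ (by exact_mod_cast hn1)
  have h2 : (n : ℝ) ^ 2 + 1 ≤ 2 * (n : ℝ) ^ 2 := by linarith
  calc ((n : ℝ) ^ 2 + 1) * (Real.exp 1 * ((n : ℝ) ^ 2 + 1) * K)
      ≤ (2 * (n : ℝ) ^ 2) * (Real.exp 1 * (2 * (n : ℝ) ^ 2) * K) := by gcongr
    _ = _ := by ring

theorem eventually_lt_natCast (b : ℝ) : ∀ᶠ n : ℕ in atTop, b < n :=
  tendsto_natCast_atTop_atTop.eventually (eventually_gt_atTop b)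

/-! ### Exponential growth of the normalizing constant. -/

/-- The sum of all graph weights. -/
noncomputable def graphSum (β : ℝ) (f : ℕ → ℝ) (n : ℕ) : ℝ :=
  ∑ G : SimpleGraph (Fin n), graphWeight (β / (n - β)) (fun i => Real.exp (f i)) G

theorem Z_eq {β : ℝ} {f : ℕ → ℝ} {n : ℕ} (hn : β < n) (hβ : 0 < β) :
    Z β f n = (1 - β / n) ^ n.choose 2 * graphSum β f n := by
  rw [Z, graphSum, Finset.mul_sum]
  exact Finset.sum_congr rfl fun G _ => weight_eq hn hβ G

theorem eventually_graphSum_le {f : ℕ → ℝ} (hf : f ∈ classF) (hneg : ∀ i, f i ≤ 0) {β : ℝ}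
    (hβ : 0 < β) {m : ℝ} (hm : ∀ θ, m ≤ dualRate β f θ) {ε : ℝ} (hε : 0 < ε) :
    ∀ᶠ n : ℕ in atTop, graphSum β f n ≤ Real.exp (n * (β / 2 - m + ε)) := by
  classical
  filter_upwards [eventually_lt_natCast (2 * β),
    eventually_prefactor_le_exp (Real.exp (8 * β ^ 2)) hε (Real.exp_pos _).le] with n hn hp
  have h := sum_graphWeight_le_exp hf hneg hβ hn.le Set.univ (m := m) (c := 0) (K := 1) le_rfl le_rfl
    (by rw [add_zero, ← dualRate_zero hf]; exact hm 0) hm fun E θ _ => Or.inl (by simpa using hm θ)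
  simp only [Set.mem_univ, Finset.filter_true] at h
  refine h.trans ?_
  have h2 := mul_le_mul_of_nonneg_right hp (Real.exp_pos (n * (β / 2 - m))).le
  rw [← Real.exp_add, show ε * n + n * (β / 2 - m) = n * (β / 2 - m + ε) by ring] at h2
  refine le_trans (le_of_eq ?_) h2
  rw [sub_zero, Real.exp_add]
  ring

theorem eventually_le_graphSum {f : ℕ → ℝ} (hf : f ∈ classF) (hanti : Antitone f) {β : ℝ}
    (hβ : 0 < β) (θ : ℝ≥0) {ε : ℝ} (hε : 0 < ε) :
    ∀ᶠ n : ℕ in atTop, Real.exp (n * (β / 2 - dualRate β f θ - ε)) ≤ graphSum β f n := by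
  have hlt : pgf f θ * Real.exp (-(ε / 2)) < pgf f θ :=
    mul_lt_of_lt_one_right (pgf_pos hf θ) (Real.exp_lt_one_iff.2 (by linarith))
  -- Truncating the degrees at `D` loses a factor at most `e^(-ε/2)` per vertex; with `D` fixed, the
  -- counting overhead is polynomial in `n` and takes the other `ε / 2`.
  obtain ⟨D, hD⟩ := (((hasSum_pgfTerm hf θ).tendsto_sum_nat.comp
    (tendsto_add_atTop_nat 1)).eventually (eventually_gt_nhds hlt)).exists
  simp only [Function.comp] at hD
  have hconst := eventually_mul_pow_le_exp
    (max 1 (θ : ℝ) ^ (D + D ^ 2 + 1) * Real.exp (D + 1)) (D + D ^ 2 + 1) (half_pos hε)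
  filter_upwards [eventually_lt_natCast β, eventually_ge_atTop 1, hconst] with n hn hn1 hK
  have hnβ : 0 < (n : ℝ) - β := by linarith
  have h := le_sum_graphWeight hn1 (div_pos hβ hnβ) (w := fun i => Real.exp (f i))
    (fun i => (Real.exp_pos _).le) (fun i j hij => Real.exp_le_exp.2 (hanti hij)) θ.coe_nonneg D
  change _ ≤ _ * graphSum β f n at h
  have hS : 0 ≤ graphSum β f n := Finset.sum_nonneg fun G _ =>
    graphWeight_nonneg (div_pos hβ hnβ).le (fun i => (Real.exp_pos _).le) G
  have h1 : Real.exp (n * (logNorm f θ - ε / 2)) ≤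
      (∑ j ∈ Finset.range (D + 1), Real.exp (f j) * (θ : ℝ) ^ j / j.factorial) ^ n := by
    rw [Real.exp_nat_mul, sub_eq_add_neg, Real.exp_add, exp_logNorm hf]
    refine pow_le_pow_left₀ (mul_nonneg (pgf_pos hf θ).le (Real.exp_pos _).le) (hD.le.trans ?_) n
    refine Finset.sum_le_sum fun j _ => le_of_eq ?_
    rw [pgfTerm]; ring
  have h2 : Real.exp (-(n * ((θ : ℝ) ^ 2 / (2 * β)))) ≤
      Real.exp (-((θ : ℝ) ^ 2 / (2 * (β / (n - β))))) := by
    rw [Real.exp_le_exp, neg_le_neg_iff]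
    have : (θ : ℝ) ^ 2 / (2 * (β / (n - β))) = (n - β) * ((θ : ℝ) ^ 2 / (2 * β)) := by field_simp
    rw [this]
    refine mul_le_mul_of_nonneg_right (by linarith) (by positivity)
  have h3 : Real.exp (n * (logNorm f θ - ε / 2)) * Real.exp (-(n * ((θ : ℝ) ^ 2 / (2 * β)))) ≤
      Real.exp (ε / 2 * n) * graphSum β f n := by
    refine (mul_le_mul h1 h2 (Real.exp_pos _).le
      ((Real.exp_pos _).le.trans h1)).trans (h.trans ?_)
    refine mul_le_mul_of_nonneg_right (le_trans (le_of_eq ?_) hK) hS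
    ring
  have h4 : Real.exp (n * (logNorm f θ - ε / 2)) * Real.exp (-(n * ((θ : ℝ) ^ 2 / (2 * β)))) =
      Real.exp (ε / 2 * n) * Real.exp (n * (β / 2 - dualRate β f θ - ε)) := by
    rw [← Real.exp_add, ← Real.exp_add, dualRate]
    congr 1
    ring
  rw [h4] at h3
  exact le_of_mul_le_mul_left h3 (Real.exp_pos _)

theorem tendsto_log_graphSum {f : ℕ → ℝ} (hf : f ∈ classF) (hanti : Antitone f)
    (hneg : ∀ i, f i ≤ 0) {β : ℝ} (hβ : 0 < β) {θ₀ : ℝ≥0}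
    (hmin : ∀ θ, dualRate β f θ₀ ≤ dualRate β f θ) :
    Tendsto (fun n : ℕ => 1 / (n : ℝ) * Real.log (graphSum β f n)) atTop
      (𝓝 (β / 2 - dualRate β f θ₀)) := by
  rw [Metric.tendsto_nhds]
  intro ε hε
  filter_upwards [eventually_graphSum_le hf hneg hβ hmin (half_pos hε),
    eventually_le_graphSum hf hanti hβ θ₀ (half_pos hε), eventually_ge_atTop 1] with n h1 h2 hn
  have hn0 : (0 : ℝ) < n := by exact_mod_cast hn
  have hpos : 0 < graphSum β f n := (Real.exp_pos _).trans_le h2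
  rw [← Real.log_le_log_iff hpos (Real.exp_pos _), Real.log_exp] at h1
  rw [← Real.log_le_log_iff (Real.exp_pos _) hpos, Real.log_exp] at h2
  rw [Real.dist_eq, abs_lt, one_div_mul_eq_div]
  constructor
  · rw [lt_sub_iff_add_lt, lt_div_iff₀ hn0]
    nlinarith
  · rw [sub_lt_iff_lt_add, div_lt_iff₀ hn0]
    nlinarith

theorem tendsto_log_prefactor (β : ℝ) :
    Tendsto (fun n : ℕ => 1 / (n : ℝ) * (n.choose 2 * Real.log (1 - β / n))) atTop
      (𝓝 (-(β / 2))) := by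
  have h := (Real.tendsto_mul_log_one_add_div_atTop (-β)).comp tendsto_natCast_atTop_atTop
  have h2 : Tendsto (fun n : ℕ => (1 - (n : ℝ)⁻¹) / 2) atTop (𝓝 ((1 - 0) / 2)) :=
    (tendsto_const_nhds.sub tendsto_inv_atTop_nhds_zero_nat).div_const 2
  have h3 := h2.mul h
  have e : (1 - 0) / 2 * -β = -(β / 2) := by ring
  rw [e] at h3
  refine h3.congr' ?_
  filter_upwards [eventually_ge_atTop 1] with n hn
  have hn0 : (n : ℝ) ≠ 0 := by positivity
  simp only [Function.comp]
  rw [Nat.cast_choose_two, neg_div, ← sub_eq_add_neg]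
  field_simp

theorem tendsto_log_Z {f : ℕ → ℝ} (hf : f ∈ classF) (hanti : Antitone f)
    (hneg : ∀ i, f i ≤ 0) {β : ℝ} (hβ : 0 < β) {θ₀ : ℝ≥0}
    (hmin : ∀ θ, dualRate β f θ₀ ≤ dualRate β f θ) :
    Tendsto (fun n : ℕ => 1 / (n : ℝ) * Real.log (Z β f n)) atTop
      (𝓝 (-dualRate β f θ₀)) := by
  have h := (tendsto_log_prefactor β).add (tendsto_log_graphSum hf hanti hneg hβ hmin)
  have e : -(β / 2) + (β / 2 - dualRate β f θ₀) = -dualRate β f θ₀ := by ring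
  rw [e] at h
  refine h.congr' ?_
  filter_upwards [eventually_lt_natCast β,
    eventually_le_graphSum hf hanti hβ θ₀ one_pos] with n hn h2
  have hn0 : (0 : ℝ) < n := hβ.trans hn
  have h1 : (0 : ℝ) < 1 - β / n := by rw [sub_pos, div_lt_one hn0]; exact hn
  rw [Z_eq hn hβ, Real.log_mul (by positivity) ((Real.exp_pos _).trans_le h2).ne', Real.log_pow]
  ring

/-! ### Concentration of the empirical degree distribution. -/

/-- A strict minimizer of the dual rate function is isolated in value. -/
theorem exists_gap {f : ℕ → ℝ} (hf : f ∈ classF) (hneg : ∀ i, f i ≤ 0) {β : ℝ} (hβ : 0 < β)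
    {θ₀ : ℝ≥0} (hlt : dualRate β f θ₀ < β / 2) (hmin : ∀ θ, dualRate β f θ₀ ≤ dualRate β f θ)
    (huniq : ∀ θ, dualRate β f θ = dualRate β f θ₀ → θ = θ₀) {δ : ℝ} (hδ : 0 < δ) :
    ∃ η > 0, dualRate β f θ₀ + η ≤ β / 2 ∧
      ∀ θ, δ ≤ dist θ θ₀ → dualRate β f θ₀ + η ≤ dualRate β f θ := by
  have hK : IsCompact (Set.Icc (0 : ℝ≥0) (2 * β).toNNReal ∩ {θ | δ ≤ dist θ θ₀}) :=
    isCompact_Icc.inter_right (isClosed_le continuous_const (continuous_id.dist continuous_const))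
  have hout : ∀ θ : ℝ≥0, ¬ θ ≤ (2 * β).toNNReal → β / 2 ≤ dualRate β f θ := fun θ h =>
    le_dualRate_of_le hf hneg hβ (Real.toNNReal_le_iff_le_coe.1 (le_of_not_ge h))
  rcases (Set.Icc (0 : ℝ≥0) (2 * β).toNNReal ∩ {θ | δ ≤ dist θ θ₀}).eq_empty_or_nonempty with
    hE | hE
  · refine ⟨β / 2 - dualRate β f θ₀, by linarith, by linarith, fun θ hθ => ?_⟩
    have : ¬ θ ≤ (2 * β).toNNReal := fun h => by
      have hmem : θ ∈ Set.Icc (0 : ℝ≥0) (2 * β).toNNReal ∩ {θ | δ ≤ dist θ θ₀} :=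
        ⟨⟨zero_le, h⟩, hθ⟩
      rw [hE] at hmem
      exact hmem
    have := hout θ this
    linarith
  · obtain ⟨θ₁, hθ₁, h1⟩ := hK.exists_isMinOn hE (continuous_dualRate hf β).continuousOn
    have hne : θ₁ ≠ θ₀ := by
      rintro rfl
      have : δ ≤ dist θ₁ θ₁ := hθ₁.2
      rw [dist_self] at this
      linarith
    have hgt : dualRate β f θ₀ < dualRate β f θ₁ :=
      (hmin θ₁).lt_of_ne fun h => hne (huniq θ₁ h.symm)
    refine ⟨min (dualRate β f θ₁) (β / 2) - dualRate β f θ₀, sub_pos.2 (lt_min hgt hlt), ?_, ?_⟩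
    · linarith [min_le_right (dualRate β f θ₁) (β / 2)]
    · intro θ hθ
      by_cases h : θ ≤ (2 * β).toNNReal
      · have h2 : dualRate β f θ₁ ≤ dualRate β f θ := h1 ⟨⟨zero_le, h⟩, hθ⟩
        linarith [min_le_left (dualRate β f θ₁) (β / 2)]
      · linarith [hout θ h, min_le_right (dualRate β f θ₁) (β / 2)]

open Classical in
theorem mean_empirical {n : ℕ} [NeZero n] (G : SimpleGraph (Fin n)) :
    (empirical G).mean = ((∑ v, G.degree v : ℕ) : ℝ) / n := by
  rw [FiniteMeanLaw.mean, tsum_eq_sum (s := Finset.range n) fun i hi => by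
    simp [empirical, degFreq_eq_zero G hi]]
  have h := sum_degFreq_mul G fun i => (i : ℝ)
  push_cast
  rw [← h, Finset.sum_div]
  refine Finset.sum_congr rfl fun i _ => ?_
  simp only [empirical]
  ring

theorem sum_filter_le_sum_sum {α ι : Type*} {s : Finset α} {I : Finset ι} {p : α → Prop}
    {R : ι → α → Prop} [DecidablePred p] [∀ i, DecidablePred (R i)] {g : α → ℝ}
    (hg : ∀ a, 0 ≤ g a) (h : ∀ a ∈ s, p a → ∃ i ∈ I, R i a) :
    ∑ a ∈ s with p a, g a ≤ ∑ i ∈ I, ∑ a ∈ s with R i a, g a := by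
  simp only [Finset.sum_filter]
  rw [Finset.sum_comm]
  refine Finset.sum_le_sum fun a ha => ?_
  have hnn : ∀ i ∈ I, 0 ≤ if R i a then g a else 0 := fun i _ => by
    split_ifs
    exacts [hg a, le_rfl]
  split_ifs with hp
  · obtain ⟨i, hi, hR⟩ := h a ha hp
    exact (if_pos hR).ge.trans (Finset.single_le_sum hnn hi)
  · exact Finset.sum_nonneg hnn

open Classical in
theorem Q_le_div {β : ℝ} {f : ℕ → ℝ} {n : ℕ} (hn : β < n) (hβ : 0 < β)
    {B : Set (SimpleGraph (Fin n))} {T : Set (Fin n → ℕ)}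
    (hBT : ∀ G ∈ B, (fun v => G.degree v) ∈ T) (hS : 0 < graphSum β f n) :
    Q β f n B ≤ (∑ G : SimpleGraph (Fin n) with (fun v => G.degree v) ∈ T,
      graphWeight (β / (n - β)) (fun i => Real.exp (f i)) G) / graphSum β f n := by
  have hn0 : (0 : ℝ) < n := hβ.trans hn
  have hnβ : 0 < (n : ℝ) - β := sub_pos.2 hn
  have h1β : (0 : ℝ) < 1 - β / n := by rw [sub_pos, div_lt_one hn0]; exact hn
  have hw : ∀ G : SimpleGraph (Fin n), weight β f G / Z β f n =
      graphWeight (β / (n - β)) (fun i => Real.exp (f i)) G / graphSum β f n := fun G => by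
    rw [weight_eq hn hβ, Z_eq hn hβ, mul_div_mul_left _ _ (pow_pos h1β _).ne']
  rw [Q, Finset.sum_congr rfl fun G _ => hw G, Finset.sum_div]
  refine Finset.sum_le_sum_of_subset_of_nonneg (fun G hG => ?_) fun G _ _ => div_nonneg
    (graphWeight_nonneg (div_pos hβ hnβ).le (fun i => (Real.exp_pos _).le) G) hS.le
  rw [Finset.mem_filter] at hG ⊢
  exact ⟨hG.1, hBT G hG.2⟩

/-- The sequences whose mean or some frequency below `L` is far from that of `σ`. -/
def deviantSeqs (n : ℕ) (σ : FiniteMeanLaw) (L : ℕ) (r ρ : ℝ) : Set (Fin n → ℕ) :=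
  {d | r ≤ ((∑ v, d v : ℕ) : ℝ) / n - σ.mean ∨
    ∃ i ∈ Finset.range L, ρ ≤ |(countEq d i : ℝ) / n - σ.mass i|}

open Classical in
theorem degree_mem_deviantSeqs {n : ℕ} [NeZero n] {σ : FiniteMeanLaw} {L : ℕ} {r ρ : ℝ}
    (hr : 0 < r) (hL : σ.mean - r / 8 < ∑ i ∈ Finset.range L, (i : ℝ) * σ.mass i)
    (hρL : (L : ℝ) * (L * ρ) ≤ r / 8) {G : SimpleGraph (Fin n)} (hG : r ≤ dist (empirical G) σ) :
    (fun v => G.degree v) ∈ deviantSeqs n σ L (r / 4) ρ := by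
  by_contra hGT
  rw [deviantSeqs, Set.mem_ofPred_eq, not_or] at hGT
  push Not at hGT
  obtain ⟨h1, h2⟩ := hGT
  refine hG.not_gt ((dist_le_mean_sub L).trans_lt ?_)
  have h0 : (empirical G).mean - σ.mean < r / 4 := by rw [mean_empirical]; exact h1
  have h3 : ∑ i ∈ Finset.range L, (i : ℝ) * |(empirical G).mass i - σ.mass i| ≤
      (L : ℝ) * (L * ρ) := by
    have h4 := Finset.sum_le_card_nsmul (Finset.range L)
      (fun i => (i : ℝ) * |(empirical G).mass i - σ.mass i|) (L * ρ) fun i hi => by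
        have h5 : |(empirical G).mass i - σ.mass i| < ρ := h2 i hi
        have h6 : (i : ℝ) ≤ L := by exact_mod_cast (Finset.mem_range.1 hi).le
        exact mul_le_mul h6 h5.le (abs_nonneg _) (Nat.cast_nonneg _)
    rwa [Finset.card_range, nsmul_eq_mul] at h4
  linarith

open Classical in
-- An excessive mean cannot occur, since `2E / n ≤ θ² / β < σ.mean + r`. What remains is a union
-- bound over the `L` frequencies.
theorem sum_deviantSeqs_le {f : ℕ → ℝ} (hf : f ∈ classF) {β : ℝ} (hβ : 0 < β) {n : ℕ} (hn : β < n)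
    {σ : FiniteMeanLaw} {L : ℕ} {r ρ : ℝ} (hρ : 0 < ρ) (hρ1 : ρ ≤ 1) {θ : ℝ≥0} {E : ℕ}
    (hθ : (θ : ℝ) ^ 2 = 2 * (β / (n - β)) * E)
    (hmass : ∀ i ∈ Finset.range L, |(sigma f hf θ).mass i - σ.mass i| ≤ ρ / 2)
    (hθsq : (θ : ℝ) ^ 2 < β * (σ.mean + r)) :
    ∑ d ∈ Fintype.piFinset (fun _ : Fin n => Finset.range n) with
        ∑ v, d v = 2 * E ∧ d ∈ deviantSeqs n σ L r ρ, ∏ v, pgfTerm f θ (d v) ≤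
      2 * L * Real.exp (-(ρ ^ 2 / 16 * n)) * pgf f θ ^ n := by
  have hn0 : (0 : ℝ) < n := hβ.trans hn
  have hnβ : 0 < (n : ℝ) - β := sub_pos.2 hn
  refine (sum_filter_le_sum_sum (I := Finset.range L)
    (R := fun i d => ρ ≤ |(countEq d i : ℝ) / n - σ.mass i|)
    (fun d => Finset.prod_nonneg fun _ _ => pgfTerm_nonneg _ _ _) ?_).trans ?_
  · rintro d - ⟨hdE, h1 | h1⟩
    · exfalso
      rw [hdE] at h1
      have h2 : ((2 * E : ℕ) : ℝ) / n ≤ (θ : ℝ) ^ 2 / β := by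
        rw [hθ]
        push_cast
        rw [div_le_div_iff₀ hn0 hβ]
        have h3 : 2 * (β / (n - β)) * E * n = 2 * E * β * (n / (n - β)) := by ring
        rw [h3]
        refine le_mul_of_one_le_right (by positivity) ?_
        rw [one_le_div hnβ]
        linarith
      have h4 : (θ : ℝ) ^ 2 / β < σ.mean + r := by
        rw [div_lt_iff₀ hβ]
        linarith
      linarith
    · exact h1
  · refine (Finset.sum_le_card_nsmul _ _ _ fun i hi =>
      sum_deviation_le hf θ i (Nat.cast_pos.1 hn0) hρ hρ1 (hmass i hi)).trans_eq ?_
    rw [Finset.card_range, nsmul_eq_mul]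
    ring

open Classical in
/-- The graph measure concentrates at the law of the minimizer of the dual rate function. -/
theorem tendsto_Q_compl {f : ℕ → ℝ} (hf : f ∈ classF) (hanti : Antitone f) (hneg : ∀ i, f i ≤ 0)
    {β : ℝ} (hβ : 0 < β) {θ₀ : ℝ≥0} (hθ₀ : 0 < θ₀) (hlt : dualRate β f θ₀ < β / 2)
    (hmin : ∀ θ, dualRate β f θ₀ ≤ dualRate β f θ)
    (huniq : ∀ θ, dualRate β f θ = dualRate β f θ₀ → θ = θ₀) {U : Set FiniteMeanLaw}
    (hU : IsOpen U) (hmem : sigma f hf θ₀ ∈ U) :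
    Tendsto (fun n : ℕ => Q β f (n + 1) {G | empirical G ∈ Uᶜ}) atTop (𝓝 0) := by
  obtain ⟨r, hr, hball⟩ := Metric.isOpen_iff.1 hU _ hmem
  set σ := sigma f hf θ₀ with hσ
  have hsq : (θ₀ : ℝ) ^ 2 = β * σ.mean := sq_eq_of_isMin hf hneg hβ hθ₀ hmin
  obtain ⟨L, hL⟩ : ∃ L, σ.mean - r / 8 < ∑ i ∈ Finset.range L, (i : ℝ) * σ.mass i :=
    ((mean_hasSum σ).tendsto_sum_nat.eventually (eventually_gt_nhds (by linarith))).exists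
  obtain ⟨ρ, hρ, hρ1, hρL⟩ : ∃ ρ : ℝ, 0 < ρ ∧ ρ ≤ 1 ∧ (L : ℝ) * (L * ρ) ≤ r / 8 := by
    refine ⟨min 1 (r / 8 / ((L : ℝ) ^ 2 + 1)), by positivity, min_le_left _ _, ?_⟩
    have h1 := min_le_right 1 (r / 8 / ((L : ℝ) ^ 2 + 1))
    rw [le_div_iff₀ (by positivity)] at h1
    have h2 : 0 < min 1 (r / 8 / ((L : ℝ) ^ 2 + 1)) := by positivity
    nlinarith
  obtain ⟨δ, hδ, hnear⟩ : ∃ δ > 0, ∀ θ : ℝ≥0, dist θ θ₀ < δ →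
      (∀ i ∈ Finset.range L, |(sigma f hf θ).mass i - σ.mass i| ≤ ρ / 2) ∧
        (θ : ℝ) ^ 2 < (θ₀ : ℝ) ^ 2 + β * (r / 4) := by
    refine Metric.eventually_nhds_iff.1 (Filter.Eventually.and ?_ ?_)
    · refine (Finset.eventually_all _).2 fun i _ => ?_
      have h := Metric.tendsto_nhds.1 ((continuous_sigma_mass hf i).tendsto θ₀) (ρ / 2) (by positivity)
      filter_upwards [h] with θ hθ
      exact hθ.le
    · have hc : Continuous fun θ : ℝ≥0 => (θ : ℝ) ^ 2 := by fun_prop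
      exact (hc.tendsto θ₀).eventually (eventually_lt_nhds (by
        have : 0 < β * (r / 4) := by positivity
        linarith))
  obtain ⟨η, hη, hηβ, hfar⟩ := exists_gap hf hneg hβ hlt hmin huniq hδ
  obtain ⟨c, hc, hcη, hcρ⟩ : ∃ c : ℝ, 0 < c ∧ c ≤ η ∧ c ≤ ρ ^ 2 / 16 :=
    ⟨min η (ρ ^ 2 / 16), by positivity, min_le_left _ _, min_le_right _ _⟩
  -- The added one keeps `1 ≤ K` even when `L = 0`.
  set K : ℝ := 2 * L + 1 with hKdef
  have hK : 1 ≤ K := by rw [hKdef]; have : (0 : ℝ) ≤ L := Nat.cast_nonneg L; linarith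
  have main : ∀ᶠ n : ℕ in atTop, ∀ [NeZero n],
      Q β f n {G | empirical G ∈ Uᶜ} ≤ Real.exp (-(c / 4) * n) := by
    filter_upwards [eventually_lt_natCast (2 * β), eventually_ge_atTop 1,
      eventually_le_graphSum hf hanti hβ θ₀ (half_pos hc),
      eventually_prefactor_le_exp (K * Real.exp (8 * β ^ 2)) (ε := c / 4) (by positivity)
        (by positivity)] with n hn hn1 hlow hpre _
    have hn0 : (0 : ℝ) < n := by exact_mod_cast hn1
    have hβn : β < n := by linarith
    have hnβ : 0 < (n : ℝ) - β := by linarith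
    have hup := sum_graphWeight_le_exp hf hneg hβ hn.le (deviantSeqs n σ L (r / 4) ρ)
      (m := dualRate β f θ₀) (c := c) (K := K) hK hc.le (by linarith) hmin (by
        intro E θ hθ
        rcases le_or_gt δ (dist θ θ₀) with h | h
        · left
          linarith [hfar θ h]
        right
        obtain ⟨hmass, hθsq⟩ := hnear θ h
        refine (sum_deviantSeqs_le hf hβ hβn hρ hρ1 hθ hmass
          (by rw [mul_add, ← hsq]; exact hθsq)).trans ?_
        refine mul_le_mul_of_nonneg_right (mul_le_mul (by linarith) ?_
          (Real.exp_pos _).le (by linarith)) (pow_pos (pgf_pos hf θ) n).le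
        rw [Real.exp_le_exp, neg_le_neg_iff]
        exact mul_le_mul_of_nonneg_right hcρ hn0.le)
    have hS : 0 < graphSum β f n := (Real.exp_pos _).trans_le hlow
    have hBT : ∀ G ∈ {G : SimpleGraph (Fin n) | empirical G ∈ Uᶜ},
        (fun v => G.degree v) ∈ deviantSeqs n σ L (r / 4) ρ := by
      intro G hG
      have hG' : empirical G ∉ U := hG
      exact degree_mem_deviantSeqs hr hL hρL
        (not_lt.1 fun h => hG' (hball (Metric.mem_ball.2 h)))
    refine (Q_le_div hβn hβ hBT hS).trans ?_
    rw [div_le_iff₀ hS]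
    refine hup.trans ?_
    -- Of the gained rate `c`, the prefactor uses `c / 4` and the lower bound for the total sum uses
    -- `c / 2`, leaving decay at rate `c / 4`.
    calc _ = ((n : ℝ) ^ 2 + 1) * (Real.exp 1 * ((n : ℝ) ^ 2 + 1) * (K * Real.exp (8 * β ^ 2))) *
            Real.exp (n * (β / 2 - dualRate β f θ₀ - c)) := by
          rw [Real.exp_add]; ring
      _ ≤ Real.exp (c / 4 * n) * Real.exp (n * (β / 2 - dualRate β f θ₀ - c)) :=
          mul_le_mul_of_nonneg_right hpre (Real.exp_pos _).le
      _ = Real.exp (-(c / 4) * n) * Real.exp (n * (β / 2 - dualRate β f θ₀ - c / 2)) := by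
          rw [← Real.exp_add, ← Real.exp_add]; congr 1; ring
      _ ≤ _ := mul_le_mul_of_nonneg_left hlow (Real.exp_pos _).le
  have hlim : Tendsto (fun n : ℕ => Real.exp (-(c / 4) * (n + 1 : ℕ))) atTop (𝓝 0) := by
    refine Real.tendsto_exp_atBot.comp ?_
    exact (tendsto_natCast_atTop_atTop.comp (tendsto_add_atTop_nat 1)).const_mul_atTop_of_neg
      (by linarith)
  refine squeeze_zero' ?_ ?_ hlim
  · filter_upwards [eventually_lt_natCast β] with n hn
    have hn' : β < (n + 1 : ℕ) := by push_cast; linarith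
    have hn0 : (0 : ℝ) < (n + 1 : ℕ) := hβ.trans hn'
    have h1β : (0 : ℝ) < 1 - β / (n + 1 : ℕ) := by rw [sub_pos, div_lt_one hn0]; exact hn'
    have hw : ∀ G : SimpleGraph (Fin (n + 1)), 0 ≤ weight β f G := fun G => by
      unfold weight; positivity
    exact Finset.sum_nonneg fun G _ => div_nonneg (hw G) (Finset.sum_nonneg fun G _ => hw G)
  · filter_upwards [(tendsto_add_atTop_nat 1).eventually main] with n hn
    exact hn

/-! ### Divergence for positive parameter: the complete graph. -/

open Classical in
theorem weight_top (β : ℝ) (f : ℕ → ℝ) (n : ℕ) :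
    weight β f (⊤ : SimpleGraph (Fin n)) =
      (β / n) ^ n.choose 2 * Real.exp (n * f (n - 1)) := by
  have hE : ∀ (i : Fintype (⊤ : SimpleGraph (Fin n)).edgeSet),
      (@SimpleGraph.edgeFinset _ (⊤ : SimpleGraph (Fin n)) i).card = n.choose 2 := fun i => by
    have h := SimpleGraph.card_edgeFinset_top_eq_card_choose_two (V := Fin n)
    rw [Fintype.card_fin] at h
    rw [← h]
    congr!
  have hd : ∀ v (i : Fintype ((⊤ : SimpleGraph (Fin n)).neighborSet v)),
      @SimpleGraph.degree _ (⊤ : SimpleGraph (Fin n)) v i = n - 1 := fun v i => by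
    have h := SimpleGraph.complete_graph_degree (V := Fin n) v
    rw [Fintype.card_fin] at h
    rw [← h]
    congr!
  rw [weight, hE, Nat.sub_self, pow_zero, mul_one, sum_degFreq_mul]
  simp [hd]

/-- For the complete graph the reward `n * γ * (n - 1).choose k` is at least of order `n³`, against
an edge cost of order `n² log n`. -/
theorem tendsto_log_Z_atTop {β : ℝ} (hβ : 0 < β) {k : ℕ} (hk : 2 ≤ k) {γ : ℝ} (hγ : 0 < γ) :
    Tendsto (fun n : ℕ => 1 / (n : ℝ) * Real.log (Z β (starFun k γ) n)) atTop atTop := by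
  classical
  set a : ℝ := γ / (4 * k.factorial) with ha
  have ha0 : 0 < a := by positivity
  refine tendsto_atTop_mono' atTop ?_ tendsto_natCast_atTop_atTop
  -- The constant `e² / β` gives `log (β / n) ≥ 2 - 2 a n`. Then the edge term is at least `n² - a
  -- n³`, and the reward `a n³` leaves `log Z ≥ n²`.
  filter_upwards [eventually_lt_natCast β, eventually_ge_atTop (2 * k), eventually_ge_atTop 1,
    eventually_mul_pow_le_exp (Real.exp 2 / β) 1 (ε := 2 * a) (by positivity)] with n hn hnk hn1 hexp
  have hn0 : (0 : ℝ) < n := by exact_mod_cast hn1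
  have h1β : (0 : ℝ) < 1 - β / n := by rw [sub_pos, div_lt_one hn0]; exact hn
  have hw : ∀ G : SimpleGraph (Fin n), 0 ≤ weight β (starFun k γ) G := fun G => by
    unfold weight; positivity
  have hZ : (β / n) ^ n.choose 2 * Real.exp (n * starFun k γ (n - 1)) ≤ Z β (starFun k γ) n := by
    rw [← weight_top]
    exact Finset.single_le_sum (fun G _ => hw G) (Finset.mem_univ _)
  have hlog := Real.log_le_log (by positivity) hZ
  rw [Real.log_mul (by positivity) (Real.exp_pos _).ne', Real.log_pow, Real.log_exp,
    Nat.cast_choose_two] at hlog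
  have hlogn : Real.log (β / n) = Real.log β - Real.log n := Real.log_div hβ.ne' hn0.ne'
  have h2 : 2 - Real.log β + Real.log n ≤ 2 * a * n := by
    have h := Real.log_le_log (by positivity) hexp
    rwa [pow_one, Real.log_exp, Real.log_mul (by positivity) (by positivity),
      Real.log_div (by positivity) (by positivity), Real.log_exp] at h
  have h3 : a * (n : ℝ) ^ 2 ≤ starFun k γ (n - 1) := by
    have h4 := Nat.pow_le_choose (α := ℝ) k (n - 1)
    have h5 : n - 1 + 1 - k = n - k := by omega
    rw [h5] at h4
    have h6 : ((n : ℝ) / 2) ≤ ((n - k : ℕ) : ℝ) := by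
      rw [Nat.cast_sub (by omega)]
      have : (2 : ℝ) * k ≤ n := by exact_mod_cast hnk
      linarith
    have h7 : ((n : ℝ) / 2) ^ 2 ≤ ((n - k : ℕ) : ℝ) ^ k := by
      calc ((n : ℝ) / 2) ^ 2 ≤ ((n - k : ℕ) : ℝ) ^ 2 := pow_le_pow_left₀ (by positivity) h6 2
        _ ≤ _ := pow_le_pow_right₀ (by exact_mod_cast (by omega : 1 ≤ n - k)) hk
    rw [starFun, ha]
    calc γ / (4 * k.factorial) * (n : ℝ) ^ 2 = γ * (((n : ℝ) / 2) ^ 2 / k.factorial) := by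
          field_simp; ring
      _ ≤ γ * (((n - k : ℕ) : ℝ) ^ k / k.factorial) := by gcongr
      _ ≤ _ := mul_le_mul_of_nonneg_left h4 hγ.le
  have h8 : Real.log (β / n) < 0 := Real.log_neg (by positivity) ((div_lt_one hn0).2 hn)
  rw [one_div_mul_eq_div, le_div_iff₀ hn0]
  refine le_trans ?_ hlog
  have h9 : (n : ℝ) * n / 2 * Real.log (β / n) ≤ (n : ℝ) * (n - 1) / 2 * Real.log (β / n) :=
    mul_le_mul_of_nonpos_right (by nlinarith) h8.le
  have h10 : (n : ℝ) * (a * (n : ℝ) ^ 2) ≤ n * starFun k γ (n - 1) :=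
    mul_le_mul_of_nonneg_left h3 hn0.le
  have h11 : (n : ℝ) * n * (2 - 2 * a * n) ≤ n * n * Real.log (β / n) := by
    refine mul_le_mul_of_nonneg_left ?_ (by positivity)
    rw [hlogn]
    linarith
  nlinarith

end DegreeERGM

theorem theorem1p3 (β : ℝ) (hβ : 0 < β) (k : ℕ) (hk : 1 ≤ k) (γ : ℝ) :
    (2 ≤ k → 0 < γ →
      Tendsto (fun n : ℕ => 1 / (n : ℝ) * Real.log (Z β (starFun k γ) n)) atTop atTop) ∧
    (∀ hγ : γ < 0,
      (Tendsto (fun n : ℕ => ((1 / (n : ℝ) * Real.log (Z β (starFun k γ) n) : ℝ) : EReal))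
          atTop (𝓝 (⨆ μ : FiniteMeanLaw, starFunctional β k γ μ)) ∧
        (⨆ μ : FiniteMeanLaw, starFunctional β k γ μ) =
          -J β (starFun k γ) (starFun_mem_classF hk hγ) ∧
        -J β (starFun k γ) (starFun_mem_classF hk hγ) < 0) ∧
      ((starMaximizers β k γ).Nonempty ∧ (starMaximizers β k γ).Finite ∧
        starMaximizers β k γ ⊆ Omega (starFun k γ) (starFun_mem_classF hk hγ) ∧
        ∀ U : Set FiniteMeanLaw, IsOpen U → starMaximizers β k γ ⊆ U →
          Tendsto (fun n : ℕ => Q β (starFun k γ) (n + 1) {G | empirical G ∈ Uᶜ})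
            atTop (𝓝 0))) := by
  refine ⟨fun hk2 hγ => tendsto_log_Z_atTop hβ hk2 hγ, fun hγ => ?_⟩
  have hf := starFun_mem_classF hk hγ
  have hneg := starFun_nonpos (k := k) hγ
  have hanti := starFun_antitone (k := k) hγ
  obtain ⟨θ₀, hθ₀, hlt, hmin, huniq⟩ := exists_unique_min_dualRate (k := k) hk hγ hβ
  rw [iSup_starFunctional hk hγ hβ hmin, J_starFun hk hγ hβ hmin,
    starMaximizers_eq hk hγ hβ hmin huniq]
  refine ⟨⟨?_, EReal.coe_neg _, ?_⟩, Set.singleton_nonempty _, Set.finite_singleton _, ?_, ?_⟩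
  · exact continuous_coe_real_ereal.continuousAt.tendsto.comp
      (tendsto_log_Z hf hanti hneg hβ hmin)
  · rw [← EReal.coe_neg, EReal.coe_neg']
    exact neg_lt_zero.2 (dualRate_pos hf hneg ⟨k, starFun_neg hγ⟩ hβ θ₀)
  · rintro _ rfl
    exact ⟨θ₀, rfl⟩
  · intro U hU hsub
    exact tendsto_Q_compl hf hanti hneg hβ hθ₀ hlt hmin huniq hU (hsub rfl)
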